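/- For a finite non-negative Borel measure $\mu$ on $\mathbb{R}^d$ write $\widehat{\mu}(\xi)=\int_{\mathbb{R}^d} e^{-2\pi i\langle x,\xi\rangle}\,d\mu(x)$. For $\alpha,\beta>0$ and $\mu\neq 0$ define $$C_{\alpha,\beta,d}(\mu)=\frac{\big(\sup_{\xi}|\widehat{\mu}(\xi)||\xi|^\beta\big)^{\alpha}\,\big(\int |x|^\alpha\,d\mu(x)\big)^{\beta}}{\mu(\mathbb{R}^d)^{\alpha+\beta}}\in[0,\infty]$$ if $\sup_{\xi}|\widehat{\mu}(\xi)||\xi|^\beta<\infty$, and $C_{\alpha,\beta,d}(\mu)=\infty$ otherwise. Let $C^*_{\alpha,\beta,d}=\inf_{\mu} C_{\alpha,\beta,d}(\mu)$, the infimum being taken over all non-zero finite non-negative Borel measures $\mu$ on $\mathbb{R}^d$. For a non-negative integrable function $f$, write $C_{\alpha,\beta,d}(f)$ for the value at the measure $f\,dx$. The following hold. 1. For $f_1(x)=\mathbf{1}_{[-1/2,1/2]}(x)$ on $\mathbb{R}$ and every real $\alpha\ge 2$, $$C^*_{\alpha,1,1}=C_{\alpha,1,1}(f_1)=\frac{1}{(2\pi)^\alpha(\alpha+1)}.$$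 2. For $f_2(x)=(1-|x|)\mathbf{1}_{[-1,1]}(x)$ on $\mathbb{R}$, $$C^*_{1,2,1}=C_{1,2,1}(f_2)=\frac{1}{9\pi^2}.$$ 3. For $f_3(x)=|x|^{-1}\mathbf{1}_{[0,1]}(|x|)$ on $\mathbb{R}^3$, $$C^*_{1,2,3}=C_{1,2,3}(f_3)=\frac{4}{9\pi^2}.$$ 4. Let $\mu_4$ be the surface measure of the unit sphere $\mathbb{S}^2$, regarded as a measure on $\mathbb{R}^3$ (of total mass $4\pi$). Suppose that either $\beta=1$ and $\alpha\ge(\frac{\pi}{2}-1)^{-1}$, or $0<\beta<1$ and $\alpha\ge 2$. Let $\lambda_1=\frac14$ and, for $0<\beta<1$, let $\lambda_\beta$ be the unique $\lambda\in(0,\frac14)$ with $2\pi\lambda=(1-\beta)\tan(2\pi\lambda)$ (such a $\lambda$ exists and is unique). Then $$C^*_{\alpha,\beta,3}=C_{\alpha,\beta,3}(\mu_4)=\left(\frac{\sin(2\pi\lambda_\beta)}{2\pi\lambda_\beta^{1-\beta}}\right)^{\alpha}.$$ -/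

import Mathlib

open MeasureTheory Set
open scoped ENNReal

noncomputable section

namespace AveragingUncertainty

/-- The Euclidean space `ℝ³` with its Euclidean norm. -/
abbrev E3 : Type := EuclideanSpace ℝ (Fin 3)

section Functional

variable {E : Type*} [NormedAddCommGroup E] [InnerProductSpace ℝ E] [MeasurableSpace E]

/-- The Fourier transform `ξ ↦ ∫ exp (-2πi⟨x, ξ⟩) dμ(x)` of a finite measure. -/
def fourierMeasure (μ : Measure E) (ξ : E) : ℂ :=
  ∫ x, Complex.exp (-2 * Real.pi * Complex.I * (inner ℝ x ξ : ℝ)) ∂μ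

/-- The norm `‖μ̂(ξ) |ξ|^β‖_∞` in `[0, ∞]`. For a finite measure and `β > 0` the function under
the norm is continuous, so its `L^∞` norm is its supremum. -/
def weightedFourierNorm (β : ℝ) (μ : Measure E) : ℝ≥0∞ :=
  ⨆ ξ : E, ‖fourierMeasure μ ξ‖ₑ * ‖ξ‖ₑ ^ β

/-- The moment `I_μ(|x|^α)` in `[0, ∞]`. -/
def moment (α : ℝ) (μ : Measure E) : ℝ≥0∞ :=
  ∫⁻ x, ‖x‖ₑ ^ α ∂μ

open Classical in
/-- The functional `C_{α,β,d}(μ)` for a nonnegative measure `μ` on the `d`-dimensional Euclidean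
space `E`; it is `∞` by definition if `‖μ̂(ξ) |ξ|^β‖_∞ = ∞`. The total variation of a nonnegative
measure is its total mass. -/
def C (α β : ℝ) (μ : Measure E) : ℝ≥0∞ :=
  if weightedFourierNorm β μ = ∞ then ∞
  else weightedFourierNorm β μ ^ α * moment α μ ^ β / μ univ ^ (α + β)

variable (E) in
/-- The optimal constant `C*_{α,β,d}`: the infimum of `C_{α,β,d}(μ)` over the nonzero finite
nonnegative measures `μ` on `E`. -/
def Cstar (α β : ℝ) : ℝ≥0∞ :=
  ⨅ (μ : Measure E) (_ : IsFiniteMeasure μ) (_ : μ ≠ 0), C α β μ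

end Functional

/-- The measure `f dx` of a nonnegative density `f`. -/
def densityMeasure {E : Type*} [MeasureSpace E] (f : E → ℝ) : Measure E :=
  volume.withDensity fun x => ENNReal.ofReal (f x)

/-- The indicator function of `[-1/2, 1/2]`. -/
def f₁ : ℝ → ℝ := (Icc (-1 / 2 : ℝ) (1 / 2)).indicator fun _ => 1

/-- The tent function `(1 - |x|) 1_{[-1,1]}(x)`. -/
def f₂ : ℝ → ℝ := (Icc (-1 : ℝ) 1).indicator fun x => 1 - |x|

/-- The function `|x|⁻¹ 1_{[0,1]}(|x|)` on `ℝ³`. -/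
def f₃ : E3 → ℝ := {x : E3 | ‖x‖ ∈ Icc (0 : ℝ) 1}.indicator fun x => ‖x‖⁻¹

/-- The surface measure of the unit sphere of `ℝ³`, of total mass `4π`, as a measure on `ℝ³`. -/
def μ₄ : Measure E3 :=
  (volume : Measure E3).toSphere.map ((↑) : Metric.sphere (0 : E3) 1 → E3)

/-- The condition that determines `λ_β`, for `0 < β ≤ 1`. -/
def IsLambda (β l : ℝ) : Prop :=
  (β = 1 ∧ l = 1 / 4) ∨
  (β < 1 ∧ l ∈ Ioo (0 : ℝ) (1 / 4) ∧
    2 * Real.pi * l = (1 - β) * Real.tan (2 * Real.pi * l))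

end AveragingUncertainty

end

open Filter Topology

namespace AveragingUncertainty

/-! ### Duality: lower bounds for the functional from minorants of the weight -/

section General

variable {E : Type*} [NormedAddCommGroup E] [InnerProductSpace ℝ E] [MeasurableSpace E]
  {μ : Measure E} {α β : ℝ}

/-! The lower bounds come from linear duality. Averaging the characters of frequency `ρ` over
directions gives a radial kernel `k(ρ|x|)`: the cosine on the line, `sinc(2πρ|x|)` in space. Its
integral against `μ` is at most `ρ^(-β) S`, where `S` is the weighted Fourier norm. Suppose `A - ∑
c_i k(ρ_i r) ≤ r^α` for all `r ≥ 0`. Integrating this at `r = t|x|` gives, with `m` the mass and `M`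
the moment, `A m ≤ t^α M + t^(-β) D S` for every `t > 0`, where `D = ∑ |c_i| ρ_i^(-β)`. A suitable
`t` turns this into a bound for the functional: these are `ofReal_le_C_of_kernel` and
`ofReal_le_C_of_linear`.

A measure is extremal when it lives where the minorant touches `r^α` and when its weighted transform
is maximal at every `ρ_i`, with the sign of `c_i`. This dictates the minorants. The weighted
transforms of `f₁`, `f₂`, `f₃` are `|sin(πξ)|/π`, `sin²(πξ)/π²` and `2 sin²(π|ξ|)/π`, maximal at the
half-integers, so the frequencies are `n + 1/2` and the minorant is built from an antiperiodic
Fourier series that reproduces `r^α` on the support. For `f₂` this is the triangle wave, for `f₃`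
the parabola wave divided by `r`, and for `f₁` the antiperiodic extension of `2^(-α) - |x|^α`, whose
coefficients must be shown to have sign `(-1)^n` (`abs_boxCoeff`).

For the sphere a single frequency `λ` suffices: the maximum of the weighted transform, located by
the tangent equation. The minorant `A - B sinc(2πλ r)` touches `r^α` at `r = 1`, and that it lies
below everywhere is a one-variable inequality: `minorant_two` for `α ≥ 2`, and `minorant_crit` for
`β = 1` down to the critical exponent. In each case evaluating the functional at the candidate gives
the same number, and `Cstar_eq_C` concludes. -/

theorem fourierMeasure_eq_charFun (μ : Measure E) (ξ : E) :
    fourierMeasure μ ξ = charFun μ (-(2 * Real.pi) • ξ) := by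
  rw [fourierMeasure, charFun_apply]
  refine integral_congr_ae (ae_of_all _ fun x => ?_)
  simp only [inner_smul_right]
  congr 1
  push_cast
  ring

theorem fourierMeasure_zero (μ : Measure E) : fourierMeasure μ 0 = μ.real univ := by
  simp [fourierMeasure_eq_charFun]

/-- Pointwise decay of the Fourier transform in terms of the weighted norm. -/
theorem norm_fourierMeasure_le (hS : weightedFourierNorm β μ ≠ ∞) {ξ : E} (hξ : ξ ≠ 0) :
    ‖fourierMeasure μ ξ‖ ≤ ‖ξ‖ ^ (-β) * (weightedFourierNorm β μ).toReal := by
  have hpos : 0 < ‖ξ‖ := norm_pos_iff.2 hξ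
  have h : ‖fourierMeasure μ ξ‖ₑ * ‖ξ‖ₑ ^ β ≤ weightedFourierNorm β μ :=
    le_iSup (fun ξ : E => ‖fourierMeasure μ ξ‖ₑ * ‖ξ‖ₑ ^ β) ξ
  have hreal := ENNReal.toReal_mono hS h
  rw [ENNReal.toReal_mul, ← ENNReal.toReal_rpow, toReal_enorm, toReal_enorm] at hreal
  rw [Real.rpow_neg hpos.le, inv_mul_eq_div, le_div_iff₀ (Real.rpow_pos_of_pos hpos _)]
  exact hreal

/-- The functional evaluated from the values of its three ingredients. -/
theorem C_eq_ofReal {S M m : ℝ} (hS : 0 < S) (hM : 0 < M) (hm : 0 < m)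
    (eS : weightedFourierNorm β μ = ENNReal.ofReal S) (eM : moment α μ = ENNReal.ofReal M)
    (em : μ univ = ENNReal.ofReal m) :
    C α β μ = ENNReal.ofReal (S ^ α * M ^ β / m ^ (α + β)) := by
  rw [C, if_neg (by simp [eS]), eS, eM, em, ENNReal.ofReal_rpow_of_pos hS,
    ENNReal.ofReal_rpow_of_pos hM, ENNReal.ofReal_rpow_of_pos hm,
    ← ENNReal.ofReal_mul (by positivity), ENNReal.ofReal_div_of_pos (by positivity)]

/-- A measure attaining a lower bound valid for all measures is a minimizer. -/
theorem Cstar_eq_C [IsFiniteMeasure μ] (hμ : μ ≠ 0) {c : ℝ} (hC : C α β μ = ENNReal.ofReal c)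
    (hle : ∀ ν : Measure E, IsFiniteMeasure ν → ν ≠ 0 → ENNReal.ofReal c ≤ C α β ν) :
    Cstar E α β = C α β μ := by
  refine le_antisymm ?_ ?_
  · exact iInf_le_of_le μ (iInf_le_of_le inferInstance (iInf_le_of_le hμ le_rfl))
  · rw [hC]
    exact le_iInf fun ν => le_iInf fun hfin => le_iInf fun hne => hle ν hfin hne

/-- The weighted norm is determined by an upper bound and a point where it is attained. -/
theorem weightedFourierNorm_eq_ofReal {s : ℝ}
    (hle : ∀ ξ : E, ‖fourierMeasure μ ξ‖ * ‖ξ‖ ^ β ≤ s) (hβ : 0 ≤ β)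
    (hex : ∃ ξ : E, ‖fourierMeasure μ ξ‖ * ‖ξ‖ ^ β = s) :
    weightedFourierNorm β μ = ENNReal.ofReal s := by
  have key : ∀ ξ : E, ‖fourierMeasure μ ξ‖ₑ * ‖ξ‖ₑ ^ β
      = ENNReal.ofReal (‖fourierMeasure μ ξ‖ * ‖ξ‖ ^ β) := fun ξ => by
    rw [ENNReal.ofReal_mul (norm_nonneg _), ← ENNReal.ofReal_rpow_of_nonneg (norm_nonneg _) hβ,
      ofReal_norm, ofReal_norm]
  obtain ⟨ξ, hξ⟩ := hex
  refine le_antisymm (iSup_le fun ξ => ?_) ?_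
  · rw [key]; exact ENNReal.ofReal_le_ofReal (hle ξ)
  · rw [← hξ, ← key]
    exact le_iSup (fun ξ : E => ‖fourierMeasure μ ξ‖ₑ * ‖ξ‖ₑ ^ β) ξ

variable [BorelSpace E] [SecondCountableTopology E]

theorem continuous_fourierMeasure (μ : Measure E) [IsFiniteMeasure μ] :
    Continuous (fourierMeasure μ) := by
  have : fourierMeasure μ = fun ξ => charFun μ (-(2 * Real.pi) • ξ) :=
    funext (fourierMeasure_eq_charFun μ)
  rw [this]
  exact continuous_charFun.comp (continuous_const_smul _)

/-- If the norm vanished, the transform would vanish off the origin, hence by continuity also at the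
origin, where it equals the mass. `Nontrivial E` makes the origin a limit of other points. -/
theorem weightedFourierNorm_ne_zero [Nontrivial E] [IsFiniteMeasure μ] (hμ : μ ≠ 0) :
    weightedFourierNorm β μ ≠ 0 := by
  intro h0
  have hz : ∀ ξ : E, ξ ≠ 0 → fourierMeasure μ ξ = 0 := by
    intro ξ hξ
    have := norm_fourierMeasure_le (β := β) (μ := μ) (by rw [h0]; simp) hξ
    rw [h0] at this
    simpa using this
  have hc : Tendsto (fourierMeasure μ) (𝓝[≠] 0) (𝓝 (fourierMeasure μ 0)) :=
    (continuous_fourierMeasure μ).continuousAt.mono_left nhdsWithin_le_nhds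
  have hc0 : Tendsto (fourierMeasure μ) (𝓝[≠] (0 : E)) (𝓝 0) := by
    refine tendsto_const_nhds.congr' ?_
    filter_upwards [self_mem_nhdsWithin] with ξ hξ
    exact (hz ξ hξ).symm
  have : NeBot (𝓝[≠] (0 : E)) := Module.punctured_nhds_neBot ℝ E 0
  have := tendsto_nhds_unique hc hc0
  rw [fourierMeasure_zero] at this
  have h1 : μ.real univ = 0 := by exact_mod_cast this
  rw [measureReal_eq_zero_iff, Measure.measure_univ_eq_zero] at h1
  exact hμ h1

/-- A dilation-invariant family of linear inequalities between mass, moment and weighted norm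
yields a lower bound for the functional. -/
theorem ofReal_le_C_of_linear [Nontrivial E] [IsFiniteMeasure μ] (hμ : μ ≠ 0) (hα : 0 < α)
    (hβ : 0 < β) {A a D : ℝ} (ha : 0 < a) (haA : a < A) (hD : 0 < D)
    (H : weightedFourierNorm β μ ≠ ∞ → moment α μ ≠ ∞ → ∀ t > 0,
      A * μ.real univ ≤ t ^ α * (moment α μ).toReal
        + t ^ (-β) * (D * (weightedFourierNorm β μ).toReal)) :
    ENNReal.ofReal (((A - a) / D) ^ α * a ^ β) ≤ C α β μ := by
  unfold C
  split_ifs with hS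
  · exact le_top
  have hS0 : weightedFourierNorm β μ ≠ 0 := weightedFourierNorm_ne_zero hμ
  have hm0 : μ univ ≠ 0 := by simpa using hμ
  have hmtop : μ univ ≠ ∞ := measure_ne_top μ _
  have hmp : μ univ ^ (α + β) ≠ 0 := by simp [hm0, hmtop]
  have hmt : μ univ ^ (α + β) ≠ ∞ := by simp [hmtop, hm0]
  by_cases hM : moment α μ = ∞
  · have : weightedFourierNorm β μ ^ α ≠ 0 := by simp [hS0, hS]
    rw [hM, ENNReal.top_rpow_of_pos hβ, ENNReal.mul_top this, ENNReal.top_div_of_ne_top hmt]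
    exact le_top
  set S := (weightedFourierNorm β μ).toReal with hSdef
  set M := (moment α μ).toReal with hMdef
  set m := μ.real univ with hmdef
  have hSpos : 0 < S := ENNReal.toReal_pos hS0 hS
  have hmpos : 0 < m := ENNReal.toReal_pos hm0 hmtop
  have H' := H hS hM
  -- If the moment were zero, letting `t → ∞` would send the right-hand side to `0`, against `A m >
  -- 0`.
  have hMpos : 0 < M := by
    rcases (ENNReal.toReal_nonneg (a := moment α μ)).lt_or_eq with h | h
    · exact h
    exfalso
    rw [← hMdef] at h
    have hlim : Tendsto (fun t : ℝ => t ^ α * M + t ^ (-β) * (D * S)) atTop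
        (𝓝 (0 + 0 * (D * S))) := by
      rw [← h]
      simpa using ((tendsto_rpow_neg_atTop hβ).mul_const (D * S))
    have := ge_of_tendsto hlim ((eventually_gt_atTop 0).mono fun t ht => H' t ht)
    have : 0 < A * m := mul_pos (ha.trans haA) hmpos
    linarith
  -- With this dilation `t^α M = a m`, so the moment consumes the share `a` of `A` and the share `A
  -- - a` bounds `S` from below. The best share is `a = Aβ/(α+β)`, which every application supplies.
  set t := (a * m / M) ^ (1 / α) with ht
  have hq : 0 < a * m / M := by positivity
  have htpos : 0 < t := Real.rpow_pos_of_pos hq _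
  have htα : t ^ α = a * m / M := by
    rw [ht, ← Real.rpow_mul hq.le, one_div_mul_cancel hα.ne', Real.rpow_one]
  have h1 := H' t htpos
  rw [htα, div_mul_cancel₀ _ hMpos.ne'] at h1
  have htβ : 0 < t ^ β := Real.rpow_pos_of_pos htpos _
  have h2 : (A - a) / D * m * t ^ β ≤ S := by
    rw [Real.rpow_neg htpos.le] at h1
    have : (A - a) * m ≤ (t ^ β)⁻¹ * (D * S) := by linarith
    rw [inv_mul_eq_div, le_div_iff₀ htβ] at this
    rw [div_mul_eq_mul_div, div_mul_eq_mul_div, div_le_iff₀ hD]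
    linarith
  have hk : 0 < (A - a) / D := div_pos (by linarith) hD
  have h3 : (((A - a) / D) ^ α * a ^ β) * m ^ (α + β) ≤ S ^ α * M ^ β := by
    have h4 : ((A - a) / D * m * t ^ β) ^ α ≤ S ^ α :=
      Real.rpow_le_rpow (by positivity) h2 hα.le
    have h5 : (t ^ β) ^ α = a ^ β * m ^ β / M ^ β := by
      rw [← Real.rpow_mul htpos.le, mul_comm, Real.rpow_mul htpos.le, htα,
        Real.div_rpow (by positivity) hMpos.le, Real.mul_rpow ha.le hmpos.le]
    rw [Real.mul_rpow (by positivity) htβ.le, Real.mul_rpow hk.le hmpos.le, h5] at h4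
    have hMβ : 0 < M ^ β := Real.rpow_pos_of_pos hMpos _
    rw [← mul_div_assoc, div_le_iff₀ hMβ] at h4
    rw [Real.rpow_add hmpos]
    linarith
  rw [ENNReal.le_div_iff_mul_le (Or.inl hmp) (Or.inl hmt)]
  have e1 : μ univ = ENNReal.ofReal m := (ENNReal.ofReal_toReal hmtop).symm
  have e2 : weightedFourierNorm β μ = ENNReal.ofReal S := (ENNReal.ofReal_toReal hS).symm
  have e3 : moment α μ = ENNReal.ofReal M := (ENNReal.ofReal_toReal hM).symm
  rw [e1, e2, e3, ENNReal.ofReal_rpow_of_pos hmpos, ENNReal.ofReal_rpow_of_pos hSpos,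
    ENNReal.ofReal_rpow_of_pos hMpos, ← ENNReal.ofReal_mul (by positivity),
    ← ENNReal.ofReal_mul (by positivity)]
  exact ENNReal.ofReal_le_ofReal h3

/-- The linear inequality behind the lower bounds: `k` is the radial kernel obtained by averaging
the characters of frequency `ρ`, and `A - ∑ c i k(ρ i r)` minorizes the weight `r ^ α`. -/
theorem ofReal_le_C_of_kernel [Nontrivial E] [IsFiniteMeasure μ] (hμ : μ ≠ 0) (hα : 0 < α)
    (hβ : 0 < β) {A a D : ℝ} (ha : 0 < a) (haA : a < A) (hD : 0 < D)
    {k : ℝ → ℝ} (hkc : Continuous k) (hk1 : ∀ x, |k x| ≤ 1)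
    (hk : weightedFourierNorm β μ ≠ ∞ → ∀ ρ > 0,
      |∫ x, k (ρ * ‖x‖) ∂μ| ≤ ρ ^ (-β) * (weightedFourierNorm β μ).toReal)
    {ι : Type*} [Countable ι] {c ρ : ι → ℝ} (hρ : ∀ i, 0 < ρ i) (hc : Summable c)
    (hDsum : HasSum (fun i => |c i| * ρ i ^ (-β)) D)
    (hmin : ∀ r, 0 ≤ r → A - ∑' i, c i * k (ρ i * r) ≤ r ^ α) :
    ENNReal.ofReal (((A - a) / D) ^ α * a ^ β) ≤ C α β μ := by
  refine ofReal_le_C_of_linear hμ hα hβ ha haA hD fun hS hM t ht => ?_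
  set S := (weightedFourierNorm β μ).toReal
  have hc' : Summable fun i => |c i| := hc.abs
  have hInt : ∀ s : ℝ, Integrable (fun x : E => k (s * ‖x‖)) μ := fun s =>
    Integrable.of_bound (by fun_prop) 1 (ae_of_all _ fun x => hk1 _)
  have hF : ∀ i, Integrable (fun x : E => c i * k (ρ i * (t * ‖x‖))) μ := fun i => by
    simpa [mul_assoc] using (hInt (ρ i * t)).const_mul (c i)
  -- Sum and integral may be exchanged because `|k| ≤ 1`, `c` is absolutely summable and the mass is
  -- finite.
  have hsum : HasSum (fun i => ∫ x, c i * k (ρ i * (t * ‖x‖)) ∂μ)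
      (∫ x, ∑' i, c i * k (ρ i * (t * ‖x‖)) ∂μ) := by
    refine hasSum_integral_of_summable_integral_norm hF ?_
    refine Summable.of_nonneg_of_le (fun i => integral_nonneg fun x => norm_nonneg _)
      (fun i => ?_) (hc'.mul_right (μ.real univ))
    calc ∫ x, ‖c i * k (ρ i * (t * ‖x‖))‖ ∂μ ≤ ∫ _, |c i| ∂μ := by
          refine integral_mono (hF i).norm (integrable_const _) fun x => ?_
          simp only [norm_mul, Real.norm_eq_abs]
          exact mul_le_of_le_one_right (abs_nonneg _) (hk1 _)
      _ = |c i| * μ.real univ := by simp [mul_comm]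
  have hle : ∫ x, ∑' i, c i * k (ρ i * (t * ‖x‖)) ∂μ ≤ t ^ (-β) * (D * S) := by
    refine hasSum_le (fun i => ?_) hsum ((hDsum.mul_right S).mul_left (t ^ (-β)))
    rw [integral_const_mul]
    have h1 := hk hS (ρ i * t) (mul_pos (hρ i) ht)
    simp_rw [mul_assoc (ρ i)] at h1
    calc c i * ∫ x, k (ρ i * (t * ‖x‖)) ∂μ ≤ |c i| * |∫ x, k (ρ i * (t * ‖x‖)) ∂μ| := by
          rw [← abs_mul]; exact le_abs_self _
      _ ≤ |c i| * ((ρ i * t) ^ (-β) * S) := by gcongr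
      _ = t ^ (-β) * (|c i| * ρ i ^ (-β) * S) := by
          rw [Real.mul_rpow (hρ i).le ht.le]; ring
  have hTint : Integrable (fun x : E => ∑' i, c i * k (ρ i * (t * ‖x‖))) μ := by
    have hcont : Continuous (fun r : ℝ => ∑' i, c i * k (ρ i * r)) := by
      refine continuous_tsum (u := fun i => |c i|) (fun i => by fun_prop) hc' fun i x => ?_
      rw [norm_mul]
      exact mul_le_of_le_one_right (abs_nonneg _) (hk1 _)
    refine Integrable.of_bound (C := ∑' i, |c i|)
      (hcont.comp (by fun_prop : Continuous fun x : E => t * ‖x‖)).aestronglyMeasurable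
      (ae_of_all _ fun x => ?_)
    refine tsum_of_norm_bounded hc'.hasSum fun i => ?_
    rw [norm_mul]
    exact mul_le_of_le_one_right (abs_nonneg _) (hk1 _)
  have hmom : (moment α μ).toReal = ∫ x, ‖x‖ ^ α ∂μ := by
    rw [integral_eq_lintegral_of_nonneg_ae (ae_of_all _ fun x => by positivity)
      (by fun_prop (disch := exact hα.le))]
    congr 1
    refine lintegral_congr fun x => ?_
    rw [← ofReal_norm, ENNReal.ofReal_rpow_of_nonneg (norm_nonneg _) hα.le]
  have hmomint : Integrable (fun x : E => ‖x‖ ^ α) μ := by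
    refine ⟨by fun_prop (disch := exact hα.le), ?_⟩
    rw [hasFiniteIntegral_iff_norm]
    refine lt_of_le_of_lt (le_of_eq ?_) (lt_top_iff_ne_top.2 hM)
    refine lintegral_congr fun x => ?_
    rw [Real.norm_of_nonneg (by positivity), ← ofReal_norm,
      ENNReal.ofReal_rpow_of_nonneg (norm_nonneg _) hα.le]
  have hfin : ∫ x, (A - ∑' i, c i * k (ρ i * (t * ‖x‖))) ∂μ ≤ ∫ x, t ^ α * ‖x‖ ^ α ∂μ := by
    refine integral_mono ((integrable_const _).sub hTint) (hmomint.const_mul _) fun x => ?_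
    have := hmin (t * ‖x‖) (by positivity)
    rwa [Real.mul_rpow ht.le (norm_nonneg _)] at this
  rw [integral_sub (integrable_const _) hTint, integral_const_mul, ← hmom, integral_const,
    smul_eq_mul] at hfin
  linarith

end General

/-! ### Fourier transform of the surface measure of the unit sphere -/

section Sphere

/-- The surface measure on the unit sphere, as a measure on the subtype. -/
noncomputable abbrev surf : Measure (Metric.sphere (0 : E3) 1) := (volume : Measure E3).toSphere

theorem integral_volumeIoiPow (n : ℕ) (v : ℝ → ℝ) :
    ∫ r : Ioi (0 : ℝ), v r ∂(Measure.volumeIoiPow n) = ∫ r in Ioi (0 : ℝ), r ^ n * v r := by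
  simp only [Measure.volumeIoiPow, ENNReal.ofReal]
  rw [integral_withDensity_eq_integral_smul,
    integral_subtype_comap measurableSet_Ioi fun a ↦ Real.toNNReal (a ^ n) • v a,
    setIntegral_congr_fun measurableSet_Ioi fun x hx ↦ ?_]
  · rw [NNReal.smul_def, Real.coe_toNNReal _ (pow_nonneg hx.out.le _), smul_eq_mul]
  · exact (measurable_subtype_coe.pow_const _).real_toNNReal

/-- Integration in polar coordinates of a product of an angular and a radial function. -/
theorem integral_angular_mul_radial (u : E3 → ℝ) (v : ℝ → ℝ) :
    ∫ x : E3, u (‖x‖⁻¹ • x) * v ‖x‖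
      = (∫ ω : Metric.sphere (0 : E3) 1, u ω ∂surf) * ∫ r in Ioi (0 : ℝ), r ^ 2 * v r := by
  calc ∫ x : E3, u (‖x‖⁻¹ • x) * v ‖x‖
      = ∫ x : ({(0)}ᶜ : Set E3), u (‖x.1‖⁻¹ • x.1) * v ‖x.1‖ ∂((volume : Measure E3).comap (↑)) := by
        rw [integral_subtype_comap (measurableSet_singleton _).compl
          fun x : E3 ↦ u (‖x‖⁻¹ • x) * v ‖x‖, restrict_compl_singleton]
    _ = ∫ p, u p.1 * v p.2 ∂(surf.prod (Measure.volumeIoiPow (Module.finrank ℝ E3 - 1))) := by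
        simpa using (volume : Measure E3).measurePreserving_homeomorphUnitSphereProd.integral_comp
          (Homeomorph.measurableEmbedding _)
          (fun p : Metric.sphere (0 : E3) 1 × Ioi (0 : ℝ) => u p.1 * v p.2)
    _ = _ := by
        rw [integral_prod_mul (fun ω : Metric.sphere (0 : E3) 1 => u ω) (fun r : Ioi (0 : ℝ) => v r),
          integral_volumeIoiPow]
        simp

theorem integral_pow_mul_exp_neg_sq_Ioi (n : ℕ) :
    ∫ r in Ioi (0 : ℝ), r ^ n * Real.exp (-r ^ 2) = Real.Gamma ((n + 1) / 2) / 2 := by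
  have := integral_rpow_mul_exp_neg_rpow (p := 2) (q := n) (by norm_num)
    (by have : (0 : ℝ) ≤ n := n.cast_nonneg
        linarith)
  simp only [Real.rpow_natCast, Real.rpow_ofNat] at this
  rw [this]
  ring

theorem integral_even_pow_mul_exp_neg_sq (n : ℕ) :
    ∫ r : ℝ, r ^ (2 * n) * Real.exp (-r ^ 2) = Real.Gamma (n + 1 / 2) := by
  have h := integral_comp_abs (f := fun r : ℝ => r ^ (2 * n) * Real.exp (-r ^ 2))
  simp only [sq_abs, (even_two_mul n).pow_abs] at h
  rw [h, integral_pow_mul_exp_neg_sq_Ioi]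
  push_cast
  rw [show ((2 : ℝ) * n + 1) / 2 = n + 1 / 2 by ring]
  ring

/-- The Gaussian factorizes over the coordinates; the two idle ones contribute `√π` each. -/
theorem integral_coord_pow_mul_gaussian (n : ℕ) :
    ∫ x : E3, x 0 ^ (2 * n) * Real.exp (-‖x‖ ^ 2) = Real.Gamma (n + 1 / 2) * Real.pi := by
  have h1 : ∀ x : E3, x 0 ^ (2 * n) * Real.exp (-‖x‖ ^ 2)
      = ∏ i : Fin 3, (fun t : ℝ => t ^ (if i = 0 then 2 * n else 2 * 0) * Real.exp (-t ^ 2))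
        (WithLp.ofLp x i) := fun x => by
    rw [EuclideanSpace.norm_sq_eq]
    simp only [Fin.prod_univ_three, Fin.sum_univ_three, Real.norm_eq_abs, sq_abs]
    rw [neg_add, neg_add, Real.exp_add, Real.exp_add]
    simp
    ring
  simp_rw [h1]
  rw [(PiLp.volume_preserving_ofLp (Fin 3)).integral_comp
    (MeasurableEquiv.toLp 2 _).symm.measurableEmbedding
    (fun y : Fin 3 → ℝ => ∏ i : Fin 3,
      (fun t : ℝ => t ^ (if i = 0 then 2 * n else 2 * 0) * Real.exp (-t ^ 2)) (y i))]
  rw [integral_fintype_prod_volume_eq_prod (fun (i : Fin 3) (t : ℝ) =>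
    t ^ (if i = 0 then 2 * n else 2 * 0) * Real.exp (-t ^ 2))]
  have h0 := integral_even_pow_mul_exp_neg_sq 0
  rw [Fin.prod_univ_three]
  simp only [Fin.isValue, ↓reduceIte, one_ne_zero, Fin.reduceEq, h0,
    integral_even_pow_mul_exp_neg_sq n]
  have hg : Real.Gamma (((0 : ℕ) : ℝ) + 1 / 2) = √Real.pi := by
    rw [Nat.cast_zero, zero_add, Real.Gamma_one_half_eq]
  rw [hg, mul_assoc, Real.mul_self_sqrt Real.pi_pos.le]

/-- By rotation invariance, pass to an orthonormal basis whose first vector is `ξ/‖ξ‖`. -/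
theorem integral_inner_pow_mul_gaussian (n : ℕ) (ξ : E3) :
    ∫ x : E3, inner ℝ x ξ ^ (2 * n) * Real.exp (-‖x‖ ^ 2)
      = ‖ξ‖ ^ (2 * n) * (Real.Gamma (n + 1 / 2) * Real.pi) := by
  rcases eq_or_ne ξ 0 with rfl | hξ
  · rcases eq_or_ne n 0 with rfl | hn
    · simpa using integral_coord_pow_mul_gaussian 0
    · simp [hn]
  have hξ' : ‖ξ‖ ≠ 0 := norm_ne_zero_iff.2 hξ
  obtain ⟨b, hb⟩ := Orthonormal.exists_orthonormalBasis_extension_of_card_eq (𝕜 := ℝ) (E := E3)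
    (ι := Fin 3) (by simp) (v := fun _ => ‖ξ‖⁻¹ • ξ) (s := {0})
    (by
      constructor
      · intro i; simp [norm_smul, hξ']
      · intro i j hij
        exact absurd (Subtype.ext (i.2.trans j.2.symm)) hij)
  have hb0 : ξ = ‖ξ‖ • b 0 := by
    rw [hb 0 rfl, smul_smul, mul_inv_cancel₀ hξ', one_smul]
  have key : ∀ x : E3, inner ℝ x ξ ^ (2 * n) * Real.exp (-‖x‖ ^ 2)
      = ‖ξ‖ ^ (2 * n) * (b.repr x 0 ^ (2 * n) * Real.exp (-‖b.repr x‖ ^ 2)) := fun x => by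
    conv_lhs => rw [hb0, inner_smul_right, real_inner_comm, ← b.repr_apply_apply x 0]
    rw [LinearIsometryEquiv.norm_map]
    ring
  simp_rw [key]
  rw [integral_const_mul, b.measurePreserving_repr.integral_comp
    b.repr.toHomeomorph.measurableEmbedding
    (fun y : E3 => y 0 ^ (2 * n) * Real.exp (-‖y‖ ^ 2)), integral_coord_pow_mul_gaussian]

/-- Even moments of the surface measure. -/
theorem integral_sphere_inner_pow (n : ℕ) (ξ : E3) :
    ∫ ω : Metric.sphere (0 : E3) 1, inner ℝ (ω : E3) ξ ^ (2 * n) ∂surf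
      = 4 * Real.pi * ‖ξ‖ ^ (2 * n) / (2 * n + 1) := by
  -- In polar coordinates the Gaussian moment is the spherical moment times a radial Gamma integral.
  -- The quotient of `Γ(n + 1/2)` by `Γ(n + 3/2)` produces the factor `1/(2n + 1)`.
  have h := integral_angular_mul_radial (fun x => inner ℝ x ξ ^ (2 * n))
    (fun r => r ^ (2 * n) * Real.exp (-r ^ 2))
  have h1 : ∀ x : E3, inner ℝ (‖x‖⁻¹ • x) ξ ^ (2 * n) * (‖x‖ ^ (2 * n) * Real.exp (-‖x‖ ^ 2))
      = inner ℝ x ξ ^ (2 * n) * Real.exp (-‖x‖ ^ 2) := fun x => by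
    rcases eq_or_ne x 0 with rfl | hx
    · rcases eq_or_ne n 0 with rfl | hn <;> simp [*]
    · have : ‖x‖ ≠ 0 := norm_ne_zero_iff.2 hx
      rw [real_inner_smul_left, ← mul_assoc, ← mul_pow]
      field_simp
  simp_rw [h1] at h
  rw [integral_inner_pow_mul_gaussian] at h
  have h2 : ∀ r : ℝ, r ^ 2 * (r ^ (2 * n) * Real.exp (-r ^ 2))
      = r ^ (2 * n + 2) * Real.exp (-r ^ 2) := fun r => by ring
  simp_rw [h2] at h
  rw [integral_pow_mul_exp_neg_sq_Ioi] at h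
  have h3 : Real.Gamma ((((2 * n + 2 : ℕ) : ℝ) + 1) / 2)
      = (n + 1 / 2) * Real.Gamma (n + 1 / 2) := by
    rw [← Real.Gamma_add_one (by positivity)]
    congr 1; push_cast; ring
  rw [h3] at h
  have hG : 0 < Real.Gamma ((n : ℝ) + 1 / 2) := Real.Gamma_pos_of_pos (by positivity)
  have hn : (0 : ℝ) < 2 * n + 1 := by positivity
  rw [eq_div_iff hn.ne']
  have := mul_left_cancel₀ hG.ne' (a := Real.Gamma ((n : ℝ) + 1 / 2))
    (b := ‖ξ‖ ^ (2 * n) * Real.pi)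
    (c := (∫ ω : Metric.sphere (0 : E3) 1, inner ℝ (ω : E3) ξ ^ (2 * n) ∂surf)
      * (n + 1 / 2) / 2) (by linear_combination h)
  linear_combination -4 * this

theorem surf_real_univ : surf.real univ = 4 * Real.pi := by
  have := integral_sphere_inner_pow 0 0
  simpa using this

/-- Integrate the Taylor series of the cosine term by term: the factor `1/(2n + 1)` of the even
moments turns `(2n)!` into `(2n + 1)!`, which is the series of `sinc`. -/
theorem integral_sphere_cos (ξ : E3) :
    ∫ ω : Metric.sphere (0 : E3) 1, Real.cos (inner ℝ (ω : E3) ξ) ∂surf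
      = 4 * Real.pi * Real.sinc ‖ξ‖ := by
  have hb : ∀ ω : Metric.sphere (0 : E3) 1, |inner ℝ (ω : E3) ξ| ≤ ‖ξ‖ := fun ω => by
    have := abs_real_inner_le_norm (ω : E3) ξ
    rwa [norm_eq_of_mem_sphere ω, one_mul] at this
  have hF : ∀ n : ℕ, Integrable (fun ω : Metric.sphere (0 : E3) 1 =>
      (-1 : ℝ) ^ n * inner ℝ (ω : E3) ξ ^ (2 * n) / (2 * n).factorial) surf := fun n =>
    Integrable.of_bound (C := ‖ξ‖ ^ (2 * n) / (2 * n).factorial)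
      (Continuous.aestronglyMeasurable (by fun_prop)) (ae_of_all _ fun ω => by
        rw [norm_div, norm_mul, norm_pow, norm_pow, norm_neg, norm_one, one_pow, one_mul,
          Real.norm_natCast]
        gcongr
        exact hb ω)
  have hs := hasSum_integral_of_summable_integral_norm hF (by
    refine Summable.of_nonneg_of_le (fun n => integral_nonneg fun x => norm_nonneg _)
      (fun n => ?_) (((Real.hasSum_cosh ‖ξ‖).summable).mul_right (surf.real univ))
    calc ∫ ω : Metric.sphere (0 : E3) 1,
          ‖(-1 : ℝ) ^ n * inner ℝ (ω : E3) ξ ^ (2 * n) / (2 * n).factorial‖ ∂surf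
        ≤ ∫ ω : Metric.sphere (0 : E3) 1, ‖ξ‖ ^ (2 * n) / (2 * n).factorial ∂surf := by
          refine integral_mono (hF n).norm (integrable_const _) fun ω => ?_
          simp only
          rw [norm_div, norm_mul, norm_pow, norm_pow, norm_neg, norm_one, one_pow, one_mul,
            Real.norm_natCast]
          gcongr
          exact hb ω
      _ = _ := by simp [mul_comm])
  have e1 : ∀ ω : Metric.sphere (0 : E3) 1,
      ∑' n : ℕ, (-1 : ℝ) ^ n * inner ℝ (ω : E3) ξ ^ (2 * n) / (2 * n).factorial
        = Real.cos (inner ℝ (ω : E3) ξ) := fun ω => (Real.hasSum_cos _).tsum_eq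
  simp_rw [e1] at hs
  refine hs.unique ?_
  have e2 : ∀ n : ℕ, ∫ ω : Metric.sphere (0 : E3) 1,
      (-1 : ℝ) ^ n * inner ℝ (ω : E3) ξ ^ (2 * n) / (2 * n).factorial ∂surf
      = 4 * Real.pi * ((-1) ^ n * ‖ξ‖ ^ (2 * n) / (2 * n + 1).factorial) := fun n => by
    rw [integral_div, integral_const_mul, integral_sphere_inner_pow, Nat.factorial_succ]
    push_cast
    field_simp
  simp_rw [e2]
  refine HasSum.mul_left _ ?_
  rcases eq_or_ne ξ 0 with rfl | hξ
  · have := hasSum_single (f := fun n : ℕ => (-1 : ℝ) ^ n * ‖(0 : E3)‖ ^ (2 * n)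
      / (2 * n + 1).factorial) 0 (fun n hn => by simp [hn])
    simpa using this
  · have hξ' : ‖ξ‖ ≠ 0 := norm_ne_zero_iff.2 hξ
    rw [Real.sinc_of_ne_zero hξ']
    have := (Real.hasSum_sin ‖ξ‖).div_const ‖ξ‖
    refine this.congr_fun fun n => ?_
    rw [pow_succ]
    field_simp

/-- The integrand is odd. The symmetry is taken from Lebesgue measure on the whole space, and a
Gaussian radial factor with nonzero integral transfers it to the sphere. -/
theorem integral_sphere_sin (ξ : E3) :
    ∫ ω : Metric.sphere (0 : E3) 1, Real.sin (inner ℝ (ω : E3) ξ) ∂surf = 0 := by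
  have h := integral_angular_mul_radial (fun x => Real.sin (inner ℝ x ξ))
    (fun r => Real.exp (-r ^ 2))
  rw [integral_pow_mul_exp_neg_sq_Ioi] at h
  have h0 : ∫ x : E3, Real.sin (inner ℝ (‖x‖⁻¹ • x) ξ) * Real.exp (-‖x‖ ^ 2) = 0 := by
    have := integral_neg_eq_self
      (fun x : E3 => Real.sin (inner ℝ (‖x‖⁻¹ • x) ξ) * Real.exp (-‖x‖ ^ 2)) volume
    simp only [norm_neg, smul_neg, inner_neg_left, Real.sin_neg, neg_mul] at this
    rw [integral_neg] at this
    linarith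
  rw [h0] at h
  have hG : 0 < Real.Gamma ((((2 : ℕ) : ℝ) + 1) / 2) := Real.Gamma_pos_of_pos (by positivity)
  rcases mul_eq_zero.1 h.symm with h | h
  · exact h
  · linarith

/-- The Fourier transform of the surface measure of the unit sphere. -/
theorem integral_sphere_exp (ξ : E3) :
    ∫ ω : Metric.sphere (0 : E3) 1,
        Complex.exp (-2 * Real.pi * Complex.I * (inner ℝ (ω : E3) ξ : ℝ)) ∂surf
      = (4 * Real.pi * Real.sinc (2 * Real.pi * ‖ξ‖) : ℝ) := by
  have e : ∀ ω : Metric.sphere (0 : E3) 1,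
      Complex.exp (-2 * Real.pi * Complex.I * (inner ℝ (ω : E3) ξ : ℝ))
        = (Real.cos (inner ℝ (ω : E3) ((2 * Real.pi) • ξ)) : ℂ)
          - (Real.sin (inner ℝ (ω : E3) ((2 * Real.pi) • ξ)) : ℂ) * Complex.I := fun ω => by
    rw [inner_smul_right, show -2 * (Real.pi : ℂ) * Complex.I * ((inner ℝ (ω : E3) ξ : ℝ) : ℂ)
      = ((-(2 * Real.pi * inner ℝ (ω : E3) ξ) : ℝ) : ℂ) * Complex.I by push_cast; ring,
      Complex.exp_mul_I, ← Complex.ofReal_cos, ← Complex.ofReal_sin, Real.cos_neg, Real.sin_neg]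
    push_cast
    ring
  have i1 : Integrable (fun ω : Metric.sphere (0 : E3) 1 =>
      (Real.cos (inner ℝ (ω : E3) ((2 * Real.pi) • ξ)) : ℂ)) surf :=
    Integrable.of_bound (C := 1) (Continuous.aestronglyMeasurable (by fun_prop))
      (ae_of_all _ fun ω => by
        rw [Complex.norm_real]; exact Real.abs_cos_le_one _)
  have i2 : Integrable (fun ω : Metric.sphere (0 : E3) 1 =>
      (Real.sin (inner ℝ (ω : E3) ((2 * Real.pi) • ξ)) : ℂ) * Complex.I) surf :=
    Integrable.of_bound (C := 1) (Continuous.aestronglyMeasurable (by fun_prop))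
      (ae_of_all _ fun ω => by
        rw [norm_mul, Complex.norm_I, mul_one, Complex.norm_real]; exact Real.abs_sin_le_one _)
  simp_rw [e]
  rw [integral_sub i1 i2, integral_mul_const, integral_complex_ofReal, integral_complex_ofReal,
    integral_sphere_cos, integral_sphere_sin, norm_smul, Real.norm_of_nonneg (by positivity)]
  simp

theorem fourierMeasure_μ₄ (ξ : E3) :
    fourierMeasure μ₄ ξ = (4 * Real.pi * Real.sinc (2 * Real.pi * ‖ξ‖) : ℝ) := by
  rw [fourierMeasure, μ₄, integral_map (by fun_prop)
    (Continuous.aestronglyMeasurable (by fun_prop)), integral_sphere_exp]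

theorem μ₄_univ : μ₄ univ = ENNReal.ofReal (4 * Real.pi) := by
  rw [μ₄, Measure.map_apply (by fun_prop) MeasurableSet.univ, preimage_univ, ← surf_real_univ,
    ofReal_measureReal]

theorem moment_μ₄ (α : ℝ) : moment α μ₄ = ENNReal.ofReal (4 * Real.pi) := by
  have hm : Measurable fun x : E3 => ‖x‖ₑ ^ α := by fun_prop
  rw [moment, μ₄, lintegral_map hm (by fun_prop)]
  have : ∀ ω : Metric.sphere (0 : E3) 1, ‖(ω : E3)‖ₑ ^ α = 1 := fun ω => by
    rw [← ofReal_norm, norm_eq_of_mem_sphere ω]; simp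
  simp_rw [this]
  rw [lintegral_one, ← surf_real_univ, ofReal_measureReal]

instance : IsFiniteMeasure μ₄ := ⟨by rw [μ₄_univ]; exact ENNReal.ofReal_lt_top⟩

theorem μ₄_ne_zero : μ₄ ≠ 0 := by
  rw [← Measure.measure_univ_ne_zero, μ₄_univ]
  simp [Real.pi_pos]

/-- Averaging the Fourier transform over a sphere of radius `ρ` in `ℝ³`. -/
theorem abs_integral_sinc_le {β : ℝ} {μ : Measure E3} [IsFiniteMeasure μ]
    (hS : weightedFourierNorm β μ ≠ ∞) {ρ : ℝ} (hρ : 0 < ρ) :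
    |∫ x, Real.sinc (2 * Real.pi * (ρ * ‖x‖)) ∂μ|
      ≤ ρ ^ (-β) * (weightedFourierNorm β μ).toReal := by
  set S := (weightedFourierNorm β μ).toReal
  -- Fubini: averaging the transform over frequencies of length `ρ` is integrating the transform of
  -- the sphere against `μ`.
  have hfub : ∫ ω : Metric.sphere (0 : E3) 1, fourierMeasure μ (ρ • (ω : E3)) ∂surf
      = ∫ x, (4 * Real.pi * Real.sinc (2 * Real.pi * (ρ * ‖x‖)) : ℝ) ∂μ := by
    unfold fourierMeasure
    rw [integral_integral_swap]
    · have : ∀ x : E3, ∫ ω : Metric.sphere (0 : E3) 1,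
          Complex.exp (-2 * Real.pi * Complex.I * (inner ℝ x (ρ • (ω : E3)) : ℝ)) ∂surf
          = (4 * Real.pi * Real.sinc (2 * Real.pi * (ρ * ‖x‖)) : ℝ) := fun x => by
        have := integral_sphere_exp (ρ • x)
        rw [norm_smul, Real.norm_of_nonneg hρ.le] at this
        rw [← this]
        refine integral_congr_ae (ae_of_all _ fun ω => ?_)
        simp only [inner_smul_right, real_inner_comm]
      simp_rw [this]
      rw [integral_complex_ofReal]
    · refine Integrable.of_bound (C := 1) (Continuous.aestronglyMeasurable (by fun_prop))
        (ae_of_all _ fun p => le_of_eq ?_)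
      simp only [Function.uncurry]
      rw [show -2 * (Real.pi : ℂ) * Complex.I * ((inner ℝ p.2 (ρ • (p.1 : E3)) : ℝ) : ℂ)
        = ((-(2 * Real.pi * inner ℝ p.2 (ρ • (p.1 : E3))) : ℝ) : ℂ) * Complex.I by
          push_cast; ring, Complex.norm_exp_ofReal_mul_I]
  have hle : ‖∫ ω : Metric.sphere (0 : E3) 1, fourierMeasure μ (ρ • (ω : E3)) ∂surf‖
      ≤ ρ ^ (-β) * S * surf.real univ := by
    refine norm_integral_le_of_norm_le_const (ae_of_all _ fun ω => ?_)
    have hn : ‖ρ • (ω : E3)‖ = ρ := by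
      rw [norm_smul, norm_eq_of_mem_sphere ω, Real.norm_of_nonneg hρ.le, mul_one]
    have hne : ρ • (ω : E3) ≠ 0 := by rw [← norm_pos_iff, hn]; exact hρ
    simpa [hn] using norm_fourierMeasure_le hS hne
  rw [hfub, Complex.norm_real, integral_const_mul, surf_real_univ, Real.norm_eq_abs, abs_mul,
    abs_of_pos (by positivity : 0 < 4 * Real.pi), mul_comm (4 * Real.pi)] at hle
  exact le_of_mul_le_mul_right hle (by positivity)

end Sphere

/-! ### Mass, moment and Fourier transform of measures with a density -/

section Density

theorem ne_zero_of_univ_eq_ofReal {E : Type*} [MeasurableSpace E] {μ : Measure E} {m : ℝ}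
    (hm : 0 < m) (h : μ univ = ENNReal.ofReal m) : μ ≠ 0 := by
  rw [← Measure.measure_univ_ne_zero, h]
  simpa using hm

variable {E : Type*} [MeasureSpace E] {f : E → ℝ}

theorem densityMeasure_univ (hf0 : ∀ x, 0 ≤ f x) (hf : Integrable f) :
    densityMeasure f univ = ENNReal.ofReal (∫ x, f x) := by
  rw [densityMeasure, withDensity_apply _ MeasurableSet.univ, Measure.restrict_univ,
    ofReal_integral_eq_lintegral_ofReal hf (ae_of_all _ hf0)]

theorem isFiniteMeasure_densityMeasure (hf0 : ∀ x, 0 ≤ f x) (hf : Integrable f) :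
    IsFiniteMeasure (densityMeasure f) :=
  ⟨by rw [densityMeasure_univ hf0 hf]; exact ENNReal.ofReal_lt_top⟩

theorem integral_densityMeasure {F : Type*} [NormedAddCommGroup F] [NormedSpace ℝ F]
    (hf0 : ∀ x, 0 ≤ f x) (hfm : Measurable f) (φ : E → F) :
    ∫ x, φ x ∂densityMeasure f = ∫ x, f x • φ x := by
  rw [densityMeasure, integral_withDensity_eq_integral_toReal_smul hfm.ennreal_ofReal
    (ae_of_all _ fun x => ENNReal.ofReal_lt_top)]
  simp_rw [ENNReal.toReal_ofReal (hf0 _)]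

variable [NormedAddCommGroup E] [BorelSpace E]

theorem moment_densityMeasure {α : ℝ} (hα : 0 ≤ α) (hf0 : ∀ x, 0 ≤ f x) (hfm : Measurable f)
    (hf : Integrable fun x => f x * ‖x‖ ^ α) :
    moment α (densityMeasure f) = ENNReal.ofReal (∫ x, f x * ‖x‖ ^ α) := by
  have hm : Measurable fun x : E => ‖x‖ₑ ^ α := by fun_prop
  rw [moment, densityMeasure, lintegral_withDensity_eq_lintegral_mul _ hfm.ennreal_ofReal hm,
    ofReal_integral_eq_lintegral_ofReal hf
      (ae_of_all _ fun x => mul_nonneg (hf0 x) (by positivity))]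
  refine lintegral_congr fun x => ?_
  rw [Pi.mul_apply, ENNReal.ofReal_mul (hf0 x),
    ← ENNReal.ofReal_rpow_of_nonneg (norm_nonneg _) hα, ofReal_norm]

/-- The Fourier transform of an even density is real and given by a cosine integral. -/
theorem fourierMeasure_densityMeasure [InnerProductSpace ℝ E] [SecondCountableTopology E]
    [(volume : Measure E).IsNegInvariant] (hf0 : ∀ x, 0 ≤ f x)
    (hfm : Measurable f) (hf : Integrable f) (heven : ∀ x, f (-x) = f x) (ξ : E) :
    fourierMeasure (densityMeasure f) ξ
      = ((∫ x, f x * Real.cos (2 * Real.pi * inner ℝ x ξ) : ℝ) : ℂ) := by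
  rw [fourierMeasure, integral_densityMeasure hf0 hfm]
  have e : ∀ x : E, f x • Complex.exp (-2 * Real.pi * Complex.I * (inner ℝ x ξ : ℝ))
      = ((f x * Real.cos (2 * Real.pi * inner ℝ x ξ) : ℝ) : ℂ)
        - ((f x * Real.sin (2 * Real.pi * inner ℝ x ξ) : ℝ) : ℂ) * Complex.I := fun x => by
    rw [show -2 * (Real.pi : ℂ) * Complex.I * ((inner ℝ x ξ : ℝ) : ℂ)
      = ((-(2 * Real.pi * inner ℝ x ξ) : ℝ) : ℂ) * Complex.I by push_cast; ring,
      Complex.exp_mul_I, ← Complex.ofReal_cos, ← Complex.ofReal_sin, Real.cos_neg, Real.sin_neg,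
      Complex.real_smul]
    push_cast
    ring
  have i1 : Integrable fun x => f x * Real.cos (2 * Real.pi * inner ℝ x ξ) :=
    hf.mul_bdd (c := 1) (Continuous.aestronglyMeasurable (by fun_prop))
      (ae_of_all _ fun x => Real.abs_cos_le_one _)
  have i2 : Integrable fun x => f x * Real.sin (2 * Real.pi * inner ℝ x ξ) :=
    hf.mul_bdd (c := 1) (Continuous.aestronglyMeasurable (by fun_prop))
      (ae_of_all _ fun x => Real.abs_sin_le_one _)
  have hodd : ∫ x, f x * Real.sin (2 * Real.pi * inner ℝ x ξ) = 0 := by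
    have := integral_neg_eq_self (fun x => f x * Real.sin (2 * Real.pi * inner ℝ x ξ)) volume
    simp only [heven, inner_neg_left, mul_neg, Real.sin_neg] at this
    rw [integral_neg] at this
    linarith
  simp_rw [e]
  rw [integral_sub i1.ofReal (i2.ofReal.mul_const _), integral_mul_const,
    integral_complex_ofReal, integral_complex_ofReal, hodd]
  simp

end Density

/-! ### Trigonometric series over the odd integers -/

section OddSeries

theorem hasSum_odd {f : ℕ → ℝ} {a b : ℝ} (h : HasSum f a) (he : HasSum (fun n => f (2 * n)) b) :
    HasSum (fun n => f (2 * n + 1)) (a - b) := by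
  have ho : Summable fun n => f (2 * n + 1) :=
    h.summable.comp_injective fun m n hmn => by simpa using hmn
  have := (he.even_add_odd ho.hasSum).unique h
  rw [← this, add_sub_cancel_left]
  exact ho.hasSum

/-- The right-hand side is `π² B₂(x)`, with `B₂` the second Bernoulli polynomial. -/
theorem hasSum_cos_div_sq {x : ℝ} (hx : x ∈ Icc (0 : ℝ) 1) :
    HasSum (fun n : ℕ => 1 / (n : ℝ) ^ 2 * Real.cos (2 * Real.pi * n * x))
      (Real.pi ^ 2 * (x ^ 2 - x + 1 / 6)) := by
  convert! hasSum_one_div_nat_pow_mul_cos one_ne_zero hx using 1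
  simp [Polynomial.bernoulli, Finset.sum_range_succ, Nat.choose, Nat.factorial,
    bernoulli_eq_bernoulli'_of_ne_one]
  ring

/-- The cubic is the third Bernoulli polynomial. -/
theorem hasSum_sin_div_cube {x : ℝ} (hx : x ∈ Icc (0 : ℝ) 1) :
    HasSum (fun n : ℕ => 1 / (n : ℝ) ^ 3 * Real.sin (2 * Real.pi * n * x))
      (2 * Real.pi ^ 3 / 3 * (x ^ 3 - 3 / 2 * x ^ 2 + 1 / 2 * x)) := by
  convert! hasSum_one_div_nat_pow_mul_sin one_ne_zero hx using 1
  simp [Polynomial.bernoulli, Finset.sum_range_succ, Nat.choose, Nat.factorial,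
    bernoulli_eq_bernoulli'_of_ne_one]
  ring

/-- The cosine series of the triangle wave. -/
theorem hasSum_triangle {x : ℝ} (hx : x ∈ Icc (0 : ℝ) 1) :
    HasSum (fun n : ℕ => 4 / ((2 * n + 1) * Real.pi) ^ 2 * Real.cos ((2 * n + 1) * Real.pi * x))
      (1 / 2 - x) := by
  -- At `x/2` the odd terms have angular frequencies `(2n + 1)π`, while the even terms form a
  -- quarter of the series at `x` and are subtracted.
  have h1 := hasSum_cos_div_sq (x := x / 2) ⟨by linarith [hx.1], by linarith [hx.2]⟩
  have h2 : HasSum (fun n : ℕ => 1 / ((2 * n : ℕ) : ℝ) ^ 2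
      * Real.cos (2 * Real.pi * ((2 * n : ℕ) : ℝ) * (x / 2)))
      (1 / 4 * (Real.pi ^ 2 * (x ^ 2 - x + 1 / 6))) := by
    refine ((hasSum_cos_div_sq hx).mul_left (1 / 4)).congr_fun fun n => ?_
    push_cast
    rw [show 2 * Real.pi * (2 * n) * (x / 2) = 2 * Real.pi * n * x by ring]
    ring
  have h3 := (hasSum_odd h1 h2).mul_left (4 / Real.pi ^ 2)
  convert! h3 using 1
  · ext n
    push_cast
    rw [show 2 * Real.pi * (2 * n + 1) * (x / 2) = (2 * n + 1) * Real.pi * x by ring]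
    have : (2 * (n : ℝ) + 1) ≠ 0 := by positivity
    have := Real.pi_ne_zero
    field_simp
  · have := Real.pi_ne_zero
    field_simp
    ring

/-- The even terms are removed from the sine series of `B₃` at `x/2`. Divided by `x`, this becomes a
series of `sinc` kernels with sum `1 - x`. -/
theorem hasSum_parabola {x : ℝ} (hx : x ∈ Icc (0 : ℝ) 1) :
    HasSum (fun n : ℕ => 8 / ((2 * n + 1) * Real.pi) ^ 3 * Real.sin ((2 * n + 1) * Real.pi * x))
      (x * (1 - x)) := by
  have h1 := hasSum_sin_div_cube (x := x / 2) ⟨by linarith [hx.1], by linarith [hx.2]⟩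
  have h2 : HasSum (fun n : ℕ => 1 / ((2 * n : ℕ) : ℝ) ^ 3
      * Real.sin (2 * Real.pi * ((2 * n : ℕ) : ℝ) * (x / 2)))
      (1 / 8 * (2 * Real.pi ^ 3 / 3 * (x ^ 3 - 3 / 2 * x ^ 2 + 1 / 2 * x))) := by
    refine ((hasSum_sin_div_cube hx).mul_left (1 / 8)).congr_fun fun n => ?_
    push_cast
    rw [show 2 * Real.pi * (2 * n) * (x / 2) = 2 * Real.pi * n * x by ring]
    ring
  have h3 := (hasSum_odd h1 h2).mul_left (8 / Real.pi ^ 3)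
  convert! h3 using 1
  · ext n
    push_cast
    rw [show 2 * Real.pi * (2 * n + 1) * (x / 2) = (2 * n + 1) * Real.pi * x by ring]
    have : (2 * (n : ℝ) + 1) ≠ 0 := by positivity
    have := Real.pi_ne_zero
    field_simp
  · have := Real.pi_ne_zero
    field_simp
    ring

theorem hasSum_odd_inv_sq :
    HasSum (fun n : ℕ => 4 / ((2 * n + 1) * Real.pi) ^ 2) (1 / 2) := by
  simpa using hasSum_triangle (x := 0) (by simp)

theorem hasSum_odd_inv_four :
    HasSum (fun n : ℕ => 1 / (2 * (n : ℝ) + 1) ^ 4) (Real.pi ^ 4 / 96) := by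
  have h2 : HasSum (fun n : ℕ => 1 / ((2 * n : ℕ) : ℝ) ^ 4) (1 / 16 * (Real.pi ^ 4 / 90)) := by
    refine (hasSum_zeta_four.mul_left (1 / 16)).congr_fun fun n => ?_
    push_cast
    ring
  have h3 := hasSum_odd hasSum_zeta_four h2
  convert! h3 using 1
  · ext n; push_cast; rfl
  · ring

end OddSeries

/-! ### The tent function on the line -/

section Line

/-- On the line the cosine is the averaged character. -/
theorem abs_integral_cos_le {β : ℝ} {μ : Measure ℝ} [IsFiniteMeasure μ]
    (hS : weightedFourierNorm β μ ≠ ∞) {ρ : ℝ} (hρ : 0 < ρ) :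
    |∫ x, Real.cos (2 * Real.pi * (ρ * ‖x‖)) ∂μ|
      ≤ ρ ^ (-β) * (weightedFourierNorm β μ).toReal := by
  have h := norm_fourierMeasure_le hS hρ.ne'
  rw [Real.norm_of_nonneg hρ.le] at h
  refine le_trans ?_ h
  have hre : (fourierMeasure μ ρ).re = ∫ x, Real.cos (2 * Real.pi * (ρ * ‖x‖)) ∂μ := by
    rw [fourierMeasure, ← RCLike.re_eq_complex_re, ← integral_re]
    · refine integral_congr_ae (ae_of_all _ fun x => ?_)
      simp only [RCLike.re_eq_complex_re]
      rw [show -2 * (Real.pi : ℂ) * Complex.I * ((inner ℝ x ρ : ℝ) : ℂ)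
        = ((-(2 * Real.pi * (ρ * x)) : ℝ) : ℂ) * Complex.I by
          simp only [RCLike.inner_apply, conj_trivial]; push_cast; ring,
        Complex.exp_ofReal_mul_I_re, Real.cos_neg, Real.norm_eq_abs]
      rcases abs_choice x with hx | hx <;> rw [hx]
      rw [← Real.cos_neg]; congr 1; ring
    · refine Integrable.of_bound (C := 1) (Continuous.aestronglyMeasurable (by fun_prop))
        (ae_of_all _ fun x => le_of_eq ?_)
      rw [show -2 * (Real.pi : ℂ) * Complex.I * ((inner ℝ x ρ : ℝ) : ℂ)
        = ((-(2 * Real.pi * inner ℝ x ρ) : ℝ) : ℂ) * Complex.I by push_cast; ring,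
        Complex.norm_exp_ofReal_mul_I]
  rw [← hre]
  exact Complex.abs_re_le_norm _

/-- The minorant of `r` is `1/2` minus the triangle wave. It equals `r` on `[0, 1]`, and is at most
`1` beyond because the wave is at least `-1/2`. -/
theorem C_one_two_line_ge {μ : Measure ℝ} [IsFiniteMeasure μ] (hμ : μ ≠ 0) :
    ENNReal.ofReal (1 / (9 * Real.pi ^ 2)) ≤ C 1 2 μ := by
  have hpi := Real.pi_pos
  -- Here `a = Aβ/(α+β)`, and `D = (16/π²) ∑ (2n+1)^(-4) = π²/6`.
  have key := ofReal_le_C_of_kernel (α := 1) (β := 2) hμ one_pos two_pos (A := 1 / 2) (a := 1 / 3)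
    (D := Real.pi ^ 2 / 6) (by norm_num) (by norm_num) (by positivity)
    (k := fun u => Real.cos (2 * Real.pi * u)) (by fun_prop) (fun x => Real.abs_cos_le_one _)
    (fun hS ρ hρ => abs_integral_cos_le hS hρ)
    (c := fun n : ℕ => 4 / ((2 * n + 1) * Real.pi) ^ 2) (ρ := fun n : ℕ => (n : ℝ) + 1 / 2)
    (fun n => by positivity) hasSum_odd_inv_sq.summable ?_ ?_
  · convert! key using 2
    rw [Real.rpow_one, Real.rpow_ofNat]
    field_simp
    norm_num
  · have := hasSum_odd_inv_four.mul_left (16 / Real.pi ^ 2)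
    convert! this using 1
    · ext n
      have h1 : (0 : ℝ) < 2 * n + 1 := by positivity
      rw [abs_of_nonneg (by positivity), Real.rpow_neg (by positivity), Real.rpow_ofNat]
      field_simp
      ring
    · field_simp
      norm_num
  · intro r hr
    rw [Real.rpow_one]
    have e : ∀ n : ℕ, 4 / ((2 * n + 1) * Real.pi) ^ 2
        * Real.cos (2 * Real.pi * (((n : ℝ) + 1 / 2) * r))
        = 4 / ((2 * n + 1) * Real.pi) ^ 2 * Real.cos ((2 * n + 1) * Real.pi * r) := fun n => by
      congr 2; ring
    simp_rw [e]
    rcases le_or_gt r 1 with h | h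
    · rw [(hasSum_triangle ⟨hr, h⟩).tsum_eq]; linarith
    · have : ‖∑' n : ℕ, 4 / ((2 * n + 1) * Real.pi) ^ 2 * Real.cos ((2 * n + 1) * Real.pi * r)‖
          ≤ 1 / 2 := by
        refine tsum_of_norm_bounded hasSum_odd_inv_sq fun n => ?_
        rw [norm_mul, Real.norm_of_nonneg (by positivity)]
        exact mul_le_of_le_one_right (by positivity) (Real.abs_cos_le_one _)
      have := (abs_le.1 this).1
      linarith

/-- Integrals of densities supported on a symmetric interval. -/
theorem integral_indicator_even {b : ℝ} (hb : 0 ≤ b) {g : ℝ → ℝ} (heven : ∀ x, g (-x) = g x)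
    (hg : IntervalIntegrable g volume 0 b) :
    ∫ x, (Icc (-b) b).indicator g x = 2 * ∫ x in (0 : ℝ)..b, g x := by
  rw [integral_indicator measurableSet_Icc, integral_Icc_eq_integral_Ioc,
    ← intervalIntegral.integral_of_le (by linarith)]
  have hneg : IntervalIntegrable g volume (-b) 0 := by
    have := (IntervalIntegrable.iff_comp_neg (f := g) (a := 0) (b := b)).1 hg
    simp only [heven, neg_zero] at this
    exact this.symm
  rw [← intervalIntegral.integral_add_adjacent_intervals hneg hg]
  have : ∫ x in (-b)..0, g x = ∫ x in (0 : ℝ)..b, g x := by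
    have := intervalIntegral.integral_comp_neg (f := g) (a := 0) (b := b)
    simp only [heven, neg_zero] at this
    exact this.symm
  rw [this]; ring

theorem integrable_indicator_of_continuous {a b : ℝ} {g : ℝ → ℝ} (hg : Continuous g) :
    Integrable ((Icc a b).indicator g) :=
  (integrable_indicator_iff measurableSet_Icc).2 hg.continuousOn.integrableOn_Icc

theorem f₂_nonneg (x : ℝ) : 0 ≤ f₂ x :=
  indicator_nonneg (fun x hx => by linarith [abs_le.2 hx]) x

theorem measurable_f₂ : Measurable f₂ :=
  Measurable.indicator (by fun_prop) measurableSet_Icc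

theorem integrable_f₂ : Integrable f₂ := integrable_indicator_of_continuous (by fun_prop)

theorem f₂_neg (x : ℝ) : f₂ (-x) = f₂ x := by
  have : -x ∈ Icc (-1 : ℝ) 1 ↔ x ∈ Icc (-1 : ℝ) 1 := by
    simp only [mem_Icc]; constructor <;> rintro ⟨h1, h2⟩ <;> constructor <;> linarith
  simp only [f₂, indicator, this, abs_neg]

/-- Integration of an even function against the tent. -/
theorem integral_f₂_mul {φ : ℝ → ℝ} (hφ : Continuous φ) (heven : ∀ x, φ (-x) = φ x) :
    ∫ x, f₂ x * φ x = 2 * ∫ x in (0 : ℝ)..1, (1 - x) * φ x := by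
  have e : ∀ x, f₂ x * φ x = (Icc (-1 : ℝ) 1).indicator (fun x => (1 - |x|) * φ x) x := fun x => by
    simp only [f₂, indicator]; split_ifs <;> simp
  simp_rw [e]
  rw [integral_indicator_even zero_le_one (fun x => by rw [abs_neg, heven])
    (Continuous.intervalIntegrable (by fun_prop) _ _)]
  congr 1
  refine intervalIntegral.integral_congr fun x hx => ?_
  rw [uIcc_of_le zero_le_one] at hx
  simp only [abs_of_nonneg hx.1]

theorem integral_tent_mul_cos {w : ℝ} (hw : w ≠ 0) :
    ∫ x in (0 : ℝ)..1, (1 - x) * Real.cos (w * x) = (1 - Real.cos w) / w ^ 2 := by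
  have hd : ∀ x ∈ uIcc (0 : ℝ) 1, HasDerivAt
      (fun x => (1 - x) * (Real.sin (w * x) / w) - Real.cos (w * x) / w ^ 2)
      ((1 - x) * Real.cos (w * x)) x := fun x _ => by
    have h1 : HasDerivAt (fun x : ℝ => w * x) w x := by
      simpa using (hasDerivAt_id x).const_mul w
    have h2 := (((hasDerivAt_id x).const_sub 1).mul (h1.sin.div_const w)).sub
      (h1.cos.div_const (w ^ 2))
    refine h2.congr_deriv ?_
    simp only [id]
    field_simp
    ring
  rw [intervalIntegral.integral_eq_sub_of_hasDerivAt hd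
    (Continuous.intervalIntegrable (by fun_prop) _ _)]
  simp
  ring

theorem fourierMeasure_f₂ (ξ : ℝ) :
    fourierMeasure (densityMeasure f₂) ξ
      = ((2 * ∫ x in (0 : ℝ)..1, (1 - x) * Real.cos (2 * Real.pi * ξ * x) : ℝ) : ℂ) := by
  rw [fourierMeasure_densityMeasure f₂_nonneg measurable_f₂ integrable_f₂ f₂_neg ξ,
    ← integral_f₂_mul (φ := fun x => Real.cos (2 * Real.pi * ξ * x)) (by fun_prop)
      fun x => by rw [← Real.cos_neg]; congr 1; ring]
  congr 2
  ext x
  congr 2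
  simp only [RCLike.inner_apply, conj_trivial]
  ring

/-- The maximum is reached at every half-integer, exactly the frequencies of the dual series. -/
theorem norm_fourierMeasure_f₂_mul (ξ : ℝ) :
    ‖fourierMeasure (densityMeasure f₂) ξ‖ * ‖ξ‖ ^ (2 : ℝ)
      = Real.sin (Real.pi * ξ) ^ 2 / Real.pi ^ 2 := by
  have hpi := Real.pi_pos
  rcases eq_or_ne ξ 0 with rfl | hξ
  · simp
  have hw : 2 * Real.pi * ξ ≠ 0 := by positivity
  rw [fourierMeasure_f₂, integral_tent_mul_cos hw, Complex.norm_real,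
    show 2 * Real.pi * ξ = 2 * (Real.pi * ξ) by ring, Real.cos_two_mul, Real.cos_sq',
    Real.rpow_ofNat, Real.norm_eq_abs ξ, sq_abs, Real.norm_of_nonneg (mul_nonneg zero_le_two
      (div_nonneg (by nlinarith [sq_nonneg (Real.sin (Real.pi * ξ))]) (sq_nonneg _)))]
  field_simp
  ring

theorem integral_f₂ : ∫ x, f₂ x = 1 := by
  have := integral_f₂_mul (φ := fun _ => 1) continuous_const fun _ => rfl
  simp only [mul_one] at this
  rw [this, intervalIntegral.integral_sub (by simp) (by simp)]
  simp
  norm_num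

theorem C_f₂ : C 1 2 (densityMeasure f₂) = ENNReal.ofReal (1 / (9 * Real.pi ^ 2)) := by
  have hpi := Real.pi_pos
  have hmom : ∫ x, f₂ x * ‖x‖ ^ (1 : ℝ) = 1 / 3 := by
    simp_rw [Real.rpow_one]
    rw [integral_f₂_mul (φ := fun x => ‖x‖) continuous_norm fun x => norm_neg x]
    have : ∫ x in (0 : ℝ)..1, (1 - x) * ‖x‖ = ∫ x in (0 : ℝ)..1, (x - x ^ 2) := by
      refine intervalIntegral.integral_congr fun x hx => ?_
      rw [uIcc_of_le zero_le_one] at hx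
      simp only [Real.norm_of_nonneg hx.1]; ring
    rw [this, intervalIntegral.integral_sub (Continuous.intervalIntegrable (by fun_prop) _ _)
      (Continuous.intervalIntegrable (by fun_prop) _ _)]
    simp
    norm_num
  have hmomint : Integrable fun x => f₂ x * ‖x‖ ^ (1 : ℝ) := by
    have e : (fun x => f₂ x * ‖x‖ ^ (1 : ℝ))
        = (Icc (-1 : ℝ) 1).indicator (fun x => (1 - |x|) * ‖x‖) := by
      ext x; simp only [f₂, indicator]; split_ifs <;> simp
    rw [e]; exact integrable_indicator_of_continuous (by fun_prop)
  have hS : weightedFourierNorm 2 (densityMeasure f₂) = ENNReal.ofReal (1 / Real.pi ^ 2) := by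
    refine weightedFourierNorm_eq_ofReal (fun ξ => ?_) zero_le_two ⟨1 / 2, ?_⟩
    · rw [norm_fourierMeasure_f₂_mul]
      gcongr
      exact Real.sin_sq_le_one _
    · rw [norm_fourierMeasure_f₂_mul, show Real.pi * (1 / 2) = Real.pi / 2 by ring]
      simp
  rw [C_eq_ofReal (S := 1 / Real.pi ^ 2) (M := 1 / 3) (m := 1) (by positivity) (by norm_num)
    one_pos hS (by rw [moment_densityMeasure zero_le_one f₂_nonneg measurable_f₂ hmomint, hmom])
    (by rw [densityMeasure_univ f₂_nonneg integrable_f₂, integral_f₂])]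
  congr 1
  rw [Real.rpow_one, Real.rpow_ofNat, Real.one_rpow]
  field_simp
  norm_num

end Line

/-! ### The density `|x|⁻¹` on the unit ball of space -/

section Space

/-- The minorant of `r` is `1` minus the antiperiodic parabola wave divided by `r`; on `(0, 1]` it
equals `1 - (1 - r) = r`. The coefficients are twice those of the tent, so `A` and `D` double. -/
theorem C_one_two_space_ge {μ : Measure E3} [IsFiniteMeasure μ] (hμ : μ ≠ 0) :
    ENNReal.ofReal (4 / (9 * Real.pi ^ 2)) ≤ C 1 2 μ := by
  have hpi := Real.pi_pos
  have hsum : HasSum (fun n : ℕ => 8 / ((2 * n + 1) * Real.pi) ^ 2) 1 := by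
    convert! hasSum_odd_inv_sq.mul_left 2 using 1
    · ext n; ring
    · norm_num
  have key := ofReal_le_C_of_kernel (α := 1) (β := 2) hμ one_pos two_pos (A := 1) (a := 2 / 3)
    (D := Real.pi ^ 2 / 3) (by norm_num) (by norm_num) (by positivity)
    (k := fun u => Real.sinc (2 * Real.pi * u)) (by fun_prop) (fun x => Real.abs_sinc_le_one _)
    (fun hS ρ hρ => abs_integral_sinc_le hS hρ)
    (c := fun n : ℕ => 8 / ((2 * n + 1) * Real.pi) ^ 2) (ρ := fun n : ℕ => (n : ℝ) + 1 / 2)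
    (fun n => by positivity) hsum.summable ?_ ?_
  · convert! key using 2
    rw [Real.rpow_one, Real.rpow_ofNat]
    field_simp
    norm_num
  · have := hasSum_odd_inv_four.mul_left (32 / Real.pi ^ 2)
    convert! this using 1
    · ext n
      have h1 : (0 : ℝ) < 2 * n + 1 := by positivity
      rw [abs_of_nonneg (by positivity), Real.rpow_neg (by positivity), Real.rpow_ofNat]
      field_simp
      ring
    · field_simp
      norm_num
  · intro r hr
    rw [Real.rpow_one]
    rcases hr.eq_or_lt with rfl | hr0
    · simp [hsum.tsum_eq]
    have e : ∀ n : ℕ, 8 / ((2 * n + 1) * Real.pi) ^ 2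
        * Real.sinc (2 * Real.pi * (((n : ℝ) + 1 / 2) * r))
        = 8 / ((2 * n + 1) * Real.pi) ^ 3 * Real.sin ((2 * n + 1) * Real.pi * r) / r := fun n => by
      have h1 : (0 : ℝ) < 2 * n + 1 := by positivity
      rw [show 2 * Real.pi * (((n : ℝ) + 1 / 2) * r) = (2 * n + 1) * Real.pi * r by ring,
        Real.sinc_of_ne_zero (by positivity)]
      field_simp
    rcases le_or_gt r 1 with h | h
    · simp_rw [e]
      rw [((hasSum_parabola ⟨hr, h⟩).div_const r).tsum_eq, mul_div_cancel_left₀ _ hr0.ne']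
      linarith
    -- On `(1, 2]` antiperiodicity gives the wave the value `-(r-1)(2-r)`, and the claim reduces to
    -- `2 - r ≤ r`. Beyond `2` it is enough that the series is at least `-1`.
    rcases le_or_gt r 2 with h2 | h2
    · simp_rw [e]
      have hs : HasSum (fun n : ℕ => 8 / ((2 * n + 1) * Real.pi) ^ 3
          * Real.sin ((2 * n + 1) * Real.pi * r) / r) (-((r - 1) * (1 - (r - 1))) / r) := by
        refine ((hasSum_parabola (x := r - 1)
          ⟨by linarith, by linarith⟩).neg.div_const r).congr_fun fun n => ?_
        rw [show (2 * (n : ℝ) + 1) * Real.pi * (r - 1)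
          = (2 * (n : ℝ) + 1) * Real.pi * r - Real.pi - n * (2 * Real.pi) by ring,
          Real.sin_sub_nat_mul_two_pi, Real.sin_sub_pi]
        ring
      rw [hs.tsum_eq, neg_div, sub_neg_eq_add]
      have : (r - 1) * (1 - (r - 1)) / r ≤ r - 1 := by
        rw [div_le_iff₀ hr0]; nlinarith
      linarith
    · have : ‖∑' n : ℕ, 8 / ((2 * n + 1) * Real.pi) ^ 2
          * Real.sinc (2 * Real.pi * (((n : ℝ) + 1 / 2) * r))‖ ≤ 1 := by
        refine tsum_of_norm_bounded hsum fun n => ?_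
        rw [norm_mul, Real.norm_of_nonneg (by positivity)]
        exact mul_le_of_le_one_right (by positivity) (Real.abs_sinc_le_one _)
      have := (abs_le.1 this).1
      linarith

/-- Integration in polar coordinates. -/
theorem integral_polar {g : E3 → ℝ} (hg : Integrable g) :
    ∫ x, g x = ∫ r in Ioi (0 : ℝ),
      r ^ 2 * ∫ ω : Metric.sphere (0 : E3) 1, g (r • (ω : E3)) ∂surf := by
  have hmp := (volume : Measure E3).measurePreserving_homeomorphUnitSphereProd
  have hfr : Module.finrank ℝ E3 - 1 = 2 := by simp
  rw [hfr] at hmp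
  have hx : ∀ x : ({(0)}ᶜ : Set E3), ‖x.1‖ • (‖x.1‖⁻¹ • x.1) = x.1 := fun x => by
    rw [smul_smul, mul_inv_cancel₀ (norm_ne_zero_iff.2 x.2), one_smul]
  have hInt : Integrable (fun p : Metric.sphere (0 : E3) 1 × Ioi (0 : ℝ) =>
      g ((p.2 : ℝ) • (p.1 : E3))) (surf.prod (Measure.volumeIoiPow 2)) := by
    rw [← hmp.integrable_comp_emb (Homeomorph.measurableEmbedding _)]
    simp only [Function.comp_def, homeomorphUnitSphereProd_apply_snd_coe,
      homeomorphUnitSphereProd_apply_fst_coe, hx]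
    exact (integrableOn_iff_comap_subtypeVal (measurableSet_singleton _).compl).1 hg.integrableOn
  calc ∫ x, g x
      = ∫ x : ({(0)}ᶜ : Set E3), g x ∂((volume : Measure E3).comap (↑)) := by
        rw [integral_subtype_comap (measurableSet_singleton _).compl g, restrict_compl_singleton]
    _ = ∫ p, g ((p.2 : ℝ) • (p.1 : E3)) ∂(surf.prod (Measure.volumeIoiPow 2)) := by
        rw [← hmp.integral_comp (Homeomorph.measurableEmbedding _)]
        simp only [homeomorphUnitSphereProd_apply_snd_coe,
          homeomorphUnitSphereProd_apply_fst_coe, hx]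
    _ = _ := by
        rw [integral_prod_symm _ hInt, integral_volumeIoiPow 2
          (fun r : ℝ => ∫ ω : Metric.sphere (0 : E3) 1, g (r • (ω : E3)) ∂surf)]

/-- The radial profile of the density `f₃`. -/
theorem f₃_eq (x : E3) : f₃ x = (Icc (0 : ℝ) 1).indicator (fun r => r⁻¹) ‖x‖ := rfl

theorem f₃_nonneg (x : E3) : 0 ≤ f₃ x :=
  indicator_nonneg (fun x _ => inv_nonneg.2 (norm_nonneg x)) x

theorem measurable_f₃ : Measurable f₃ :=
  Measurable.indicator (by fun_prop) (measurableSet_Icc.preimage measurable_norm)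

theorem f₃_neg (x : E3) : f₃ (-x) = f₃ x := by rw [f₃_eq, f₃_eq, norm_neg]

/-- The radial weight `r²` cancels the singularity of the density `f₃`. -/
theorem setIntegral_sq_mul_profile (w : ℝ → ℝ) :
    ∫ r in Ioi (0 : ℝ), r ^ 2 * ((Icc (0 : ℝ) 1).indicator (fun r => r⁻¹) r * w r)
      = ∫ r in (0 : ℝ)..1, r * w r := by
  rw [intervalIntegral.integral_of_le zero_le_one, ← integral_indicator measurableSet_Ioi,
    ← integral_indicator measurableSet_Ioc]
  congr 1
  ext r
  simp only [indicator, mem_Ioi, mem_Icc, mem_Ioc]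
  by_cases h0 : 0 < r
  · by_cases h1 : r ≤ 1
    · simp only [h0, h0.le, h1, and_self, if_true]; field_simp
    · simp [h1]
  · simp [h0]

/-- In polar coordinates the Jacobian `r²` absorbs the singularity `r⁻¹`. -/
theorem integrable_f₃_mul {w : ℝ → ℝ} (hw : Continuous w) :
    Integrable fun x => f₃ x * w ‖x‖ := by
  have := (integrable_fun_norm_addHaar (volume : Measure E3)
    (f := fun r => (Icc (0 : ℝ) 1).indicator (fun r => r⁻¹) r * w r)).2 (by
      have hi : Integrable ((Icc (0 : ℝ) 1).indicator fun r => r * w r) :=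
        integrable_indicator_of_continuous (by fun_prop)
      refine hi.integrableOn.congr_fun (fun r hr => ?_) measurableSet_Ioi
      have hr0 : (0 : ℝ) < r := hr
      simp only [indicator, finrank_euclideanSpace, Fintype.card_fin, smul_eq_mul, Nat.reduceSub]
      split_ifs
      · field_simp
      · simp)
  exact this

theorem integrable_f₃ : Integrable f₃ := by
  simpa using integrable_f₃_mul (w := fun _ => 1) continuous_const

theorem integral_f₃_mul (w : ℝ → ℝ) :
    ∫ x, f₃ x * w ‖x‖ = 4 * Real.pi * ∫ r in (0 : ℝ)..1, r * w r := by
  have := integral_angular_mul_radial (fun _ => 1)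
    (fun r => (Icc (0 : ℝ) 1).indicator (fun r => r⁻¹) r * w r)
  simp only [one_mul, setIntegral_sq_mul_profile, integral_const, surf_real_univ, smul_eq_mul,
    mul_one] at this
  exact this

theorem integral_f₃ : ∫ x, f₃ x = 2 * Real.pi := by
  have := integral_f₃_mul (fun _ => 1)
  simp only [mul_one, integral_id] at this
  rw [this]; ring

/-- The spherical average of the cosine is a `sinc`, whose denominator cancels the remaining radial
factor `r`; what is left is the integral of a sine over `[0, 1]`. -/
theorem integral_f₃_mul_cos {ξ : E3} (hξ : ξ ≠ 0) :
    ∫ x, f₃ x * Real.cos (2 * Real.pi * inner ℝ x ξ)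
      = 2 * Real.sin (Real.pi * ‖ξ‖) ^ 2 / (Real.pi * ‖ξ‖ ^ 2) := by
  have hpi := Real.pi_pos
  have hn : 0 < ‖ξ‖ := norm_pos_iff.2 hξ
  have hi : Integrable fun x => f₃ x * Real.cos (2 * Real.pi * inner ℝ x ξ) :=
    integrable_f₃.mul_bdd (c := 1) (Continuous.aestronglyMeasurable (by fun_prop))
      (ae_of_all _ fun x => Real.abs_cos_le_one _)
  rw [integral_polar hi]
  have e : ∀ r ∈ Ioi (0 : ℝ), r ^ 2 * ∫ ω : Metric.sphere (0 : E3) 1,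
        f₃ (r • (ω : E3)) * Real.cos (2 * Real.pi * inner ℝ (r • (ω : E3)) ξ) ∂surf
      = r ^ 2 * ((Icc (0 : ℝ) 1).indicator (fun r => r⁻¹) r
          * (4 * Real.pi * Real.sinc (2 * Real.pi * ‖ξ‖ * r))) := fun r hr => by
    have hr0 : (0 : ℝ) < r := hr
    have h1 : ∀ ω : Metric.sphere (0 : E3) 1,
        f₃ (r • (ω : E3)) * Real.cos (2 * Real.pi * inner ℝ (r • (ω : E3)) ξ)
        = (Icc (0 : ℝ) 1).indicator (fun r => r⁻¹) r
          * Real.cos (inner ℝ (ω : E3) ((2 * Real.pi * r) • ξ)) := fun ω => by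
      rw [f₃_eq, norm_smul, norm_eq_of_mem_sphere ω, mul_one, Real.norm_of_nonneg hr0.le,
        real_inner_smul_left, real_inner_smul_right]
      congr 2; ring
    simp_rw [h1]
    rw [integral_const_mul, integral_sphere_cos, norm_smul, Real.norm_of_nonneg (by positivity),
      show 2 * Real.pi * r * ‖ξ‖ = 2 * Real.pi * ‖ξ‖ * r by ring]
  rw [setIntegral_congr_fun measurableSet_Ioi e, setIntegral_sq_mul_profile]
  have e2 : ∀ r ∈ uIcc (0 : ℝ) 1, r * (4 * Real.pi * Real.sinc (2 * Real.pi * ‖ξ‖ * r))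
      = 2 / ‖ξ‖ * Real.sin (2 * Real.pi * ‖ξ‖ * r) := fun r _ => by
    rcases eq_or_ne r 0 with rfl | hr
    · simp
    · rw [Real.sinc_of_ne_zero (by positivity)]
      field_simp
      ring
  rw [intervalIntegral.integral_congr e2, intervalIntegral.integral_const_mul,
    intervalIntegral.integral_comp_mul_left (fun u => Real.sin u) (by positivity), integral_sin]
  rw [mul_zero, mul_one, Real.cos_zero, show 2 * Real.pi * ‖ξ‖ = 2 * (Real.pi * ‖ξ‖) by ring,
    Real.cos_two_mul, Real.cos_sq', smul_eq_mul]
  field_simp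
  ring

theorem norm_fourierMeasure_f₃_mul (ξ : E3) :
    ‖fourierMeasure (densityMeasure f₃) ξ‖ * ‖ξ‖ ^ (2 : ℝ)
      = 2 * Real.sin (Real.pi * ‖ξ‖) ^ 2 / Real.pi := by
  have hpi := Real.pi_pos
  rcases eq_or_ne ξ 0 with rfl | hξ
  · simp
  have hn : 0 < ‖ξ‖ := norm_pos_iff.2 hξ
  rw [fourierMeasure_densityMeasure f₃_nonneg measurable_f₃ integrable_f₃ f₃_neg ξ,
    integral_f₃_mul_cos hξ, Complex.norm_real, Real.norm_of_nonneg (by positivity),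
    Real.rpow_ofNat]
  field_simp

theorem C_f₃ : C 1 2 (densityMeasure f₃) = ENNReal.ofReal (4 / (9 * Real.pi ^ 2)) := by
  have hpi := Real.pi_pos
  have hmom : ∫ x, f₃ x * ‖x‖ ^ (1 : ℝ) = 4 * Real.pi / 3 := by
    simp_rw [Real.rpow_one]
    rw [integral_f₃_mul fun r => r]
    have : ∀ r : ℝ, r * r = r ^ 2 := fun r => by ring
    simp only [this, integral_pow]
    norm_num
    ring
  have hmomint : Integrable fun x => f₃ x * ‖x‖ ^ (1 : ℝ) := by
    simp_rw [Real.rpow_one]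
    exact integrable_f₃_mul (w := fun r => r) continuous_id
  have hS : weightedFourierNorm 2 (densityMeasure f₃) = ENNReal.ofReal (2 / Real.pi) := by
    refine weightedFourierNorm_eq_ofReal (fun ξ => ?_) zero_le_two
      ⟨EuclideanSpace.single 0 (1 / 2), ?_⟩
    · rw [norm_fourierMeasure_f₃_mul]
      gcongr
      nlinarith [Real.sin_sq_le_one (Real.pi * ‖ξ‖)]
    · rw [norm_fourierMeasure_f₃_mul, PiLp.norm_single,
        Real.norm_of_nonneg (by norm_num), show Real.pi * (1 / 2) = Real.pi / 2 by ring]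
      simp
  rw [C_eq_ofReal (S := 2 / Real.pi) (M := 4 * Real.pi / 3) (m := 2 * Real.pi) (by positivity)
    (by positivity) (by positivity) hS
    (by rw [moment_densityMeasure zero_le_one f₃_nonneg measurable_f₃ hmomint, hmom])
    (by rw [densityMeasure_univ f₃_nonneg integrable_f₃, integral_f₃])]
  congr 1
  rw [Real.rpow_one, Real.rpow_ofNat, show (1 : ℝ) + 2 = (3 : ℕ) by norm_num, Real.rpow_natCast]
  field_simp
  norm_num

end Space

/-! ### The indicator function of an interval -/

section Box

/-- The angular frequencies of the cosine series. -/
noncomputable def freq (n : ℕ) : ℝ := (2 * n + 1) * Real.pi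

theorem freq_pos (n : ℕ) : 0 < freq n := by
  have := Real.pi_pos
  unfold freq
  positivity

theorem freq_mul_half (n : ℕ) : freq n * (1 / 2) = Real.pi / 2 + n * Real.pi := by
  unfold freq; ring

theorem sin_freq_half (n : ℕ) : Real.sin (freq n * (1 / 2)) = (-1) ^ n := by
  rw [freq_mul_half, Real.sin_add_nat_mul_pi]
  simp

theorem cos_freq_add_one (n : ℕ) (x : ℝ) :
    Real.cos (freq n * (x + 1)) = -Real.cos (freq n * x) := by
  rw [show freq n * (x + 1) = freq n * x + Real.pi + n * (2 * Real.pi) by unfold freq; ring,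
    Real.cos_add_nat_mul_two_pi, Real.cos_add_pi]

theorem hasSum_freq_inv_sq : HasSum (fun n => 4 / freq n ^ 2) (1 / 2) := hasSum_odd_inv_sq

/-- The cosine series of the Green function of `-d²/dx²` with Neumann condition at `0` and
Dirichlet condition at `1/2`. -/
theorem hasSum_green {x a : ℝ} (hx : x ∈ Icc (0 : ℝ) (1 / 2)) (ha : a ∈ Icc (0 : ℝ) (1 / 2)) :
    HasSum (fun n => 4 / freq n ^ 2 * (Real.cos (freq n * x) * Real.cos (freq n * a)))
      (1 / 2 - max x a) := by
  -- The product of cosines is the mean of the cosines of difference and sum. Both arguments lie in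
  -- `[0, 1]`, and `(|x - a| + (x + a))/2 = max x a`.
  have h1 := hasSum_triangle (x := |x - a|)
    ⟨abs_nonneg _, abs_le.2 ⟨by linarith [hx.1, ha.2], by linarith [hx.2, ha.1]⟩⟩
  have h2 := hasSum_triangle (x := x + a) ⟨by linarith [hx.1, ha.1], by linarith [hx.2, ha.2]⟩
  have h3 := (h1.add h2).mul_left (1 / 2)
  convert! h3 using 1
  · ext n
    change _ = 1 / 2 * (4 / freq n ^ 2 * Real.cos (freq n * |x - a|)
      + 4 / freq n ^ 2 * Real.cos (freq n * (x + a)))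
    have : Real.cos (freq n * |x - a|) = Real.cos (freq n * (x - a)) := by
      rcases abs_choice (x - a) with h | h <;> rw [h]
      rw [mul_neg, Real.cos_neg]
    rw [this, mul_sub, mul_add (freq n), Real.cos_sub, Real.cos_add]
    ring
  · rcases le_total x a with h | h
    · rw [max_eq_right h, abs_of_nonpos (by linarith)]; ring
    · rw [max_eq_left h, abs_of_nonneg (by linarith)]; ring

variable {α : ℝ}

/-- The source term `-(d²/dx²)(-x^α)`. -/
noncomputable def source (α a : ℝ) : ℝ := α * (α - 1) * a ^ (α - 2)

theorem continuous_source (hα : 2 ≤ α) : Continuous (source α) :=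
  continuous_const.mul (Real.continuous_rpow_const (by linarith))

theorem source_nonneg (hα : 2 ≤ α) {a : ℝ} (ha : 0 ≤ a) : 0 ≤ source α a :=
  mul_nonneg (mul_nonneg (by linarith) (by linarith)) (Real.rpow_nonneg ha _)

theorem hasDerivAt_source_primitive (hα : 2 ≤ α) (a : ℝ) :
    HasDerivAt (fun a => α * a ^ (α - 1)) (source α a) a := by
  have := (Real.hasDerivAt_rpow_const (x := a) (p := α - 1) (Or.inr (by linarith))).const_mul α
  refine this.congr_deriv ?_
  rw [source, show α - 1 - 1 = α - 2 by ring]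
  ring

theorem integral_source (hα : 2 ≤ α) (b c : ℝ) :
    ∫ a in b..c, source α a = α * c ^ (α - 1) - α * b ^ (α - 1) :=
  intervalIntegral.integral_eq_sub_of_hasDerivAt (fun a _ => hasDerivAt_source_primitive hα a)
    ((continuous_source hα).intervalIntegrable _ _)

theorem half_mul_half_rpow (α : ℝ) : (1 / 2 : ℝ) ^ (α - 1) * (1 / 2) = (1 / 2) ^ α := by
  rw [Real.rpow_sub_one (by norm_num)]
  field_simp

/-- The function `2^(-α) - x^α` solves `-u'' = source` with `u'(0) = 0` and `u(1/2) = 0`; this is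
its Green representation, computed on either side of `a = x`. -/
theorem integral_source_mul_green (hα : 2 ≤ α) {x : ℝ} (hx : x ∈ Icc (0 : ℝ) (1 / 2)) :
    ∫ a in (0 : ℝ)..(1 / 2), source α a * (1 / 2 - max x a) = (1 / 2) ^ α - x ^ α := by
  have hc := continuous_source hα
  have hci : Continuous fun a => source α a * (1 / 2 - max x a) := by fun_prop
  rw [← intervalIntegral.integral_add_adjacent_intervals (b := x)
    (hci.intervalIntegrable _ _) (hci.intervalIntegrable _ _)]
  have h1 : ∫ a in (0 : ℝ)..x, source α a * (1 / 2 - max x a) = α * x ^ (α - 1) * (1 / 2 - x) := by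
    have : ∀ a ∈ uIcc 0 x, source α a * (1 / 2 - max x a) = source α a * (1 / 2 - x) := by
      intro a ha
      rw [uIcc_of_le hx.1] at ha
      rw [max_eq_left ha.2]
    rw [intervalIntegral.integral_congr this, intervalIntegral.integral_mul_const,
      integral_source hα, Real.zero_rpow (by linarith)]
    ring
  have h2 : ∫ a in x..(1 / 2), source α a * (1 / 2 - max x a)
      = (1 / 2) ^ α - (α * x ^ (α - 1) * (1 / 2 - x) + x ^ α) := by
    have : ∀ a ∈ uIcc x (1 / 2), source α a * (1 / 2 - max x a) = source α a * (1 / 2 - a) := by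
      intro a ha
      rw [uIcc_of_le hx.2] at ha
      rw [max_eq_right ha.1]
    rw [intervalIntegral.integral_congr this,
      intervalIntegral.integral_eq_sub_of_hasDerivAt
        (f := fun a => α * a ^ (α - 1) * (1 / 2 - a) + a ^ α) (fun a _ => ?_)
        (Continuous.intervalIntegrable (by fun_prop) _ _)]
    · ring
    · have h := ((hasDerivAt_source_primitive hα a).mul ((hasDerivAt_id a).const_sub (1 / 2))).add
        (Real.hasDerivAt_rpow_const (x := a) (p := α) (Or.inr (by linarith)))
      refine h.congr_deriv ?_
      simp only [id]
      ring
  rw [h1, h2]; ring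

/-- The cosine coefficients of the source term. -/
noncomputable def sourceCoeff (α : ℝ) (n : ℕ) : ℝ :=
  ∫ a in (0 : ℝ)..(1 / 2), source α a * Real.cos (freq n * a)

/-- The cosine coefficients of the antiperiodic extension of `2^{-α} - |x|^α`. -/
noncomputable def boxCoeff (α : ℝ) (n : ℕ) : ℝ := 4 / freq n ^ 2 * sourceCoeff α n

theorem abs_sourceCoeff_le (hα : 2 ≤ α) (n : ℕ) :
    |sourceCoeff α n| ≤ α * (1 / 2) ^ (α - 1) := by
  have hc := continuous_source hα
  have h : ‖sourceCoeff α n‖ ≤ ∫ a in (0 : ℝ)..(1 / 2), source α a := by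
    refine intervalIntegral.norm_integral_le_of_norm_le (by norm_num)
      (ae_of_all _ fun a ha => ?_) (hc.intervalIntegrable _ _)
    rw [norm_mul, Real.norm_of_nonneg (source_nonneg hα ha.1.le)]
    exact mul_le_of_le_one_right (source_nonneg hα ha.1.le) (Real.abs_cos_le_one _)
  rwa [integral_source hα, Real.zero_rpow (by linarith), mul_zero, sub_zero] at h

theorem abs_boxCoeff_le (hα : 2 ≤ α) (n : ℕ) :
    |boxCoeff α n| ≤ 4 / freq n ^ 2 * (α * (1 / 2) ^ (α - 1)) := by
  rw [boxCoeff, abs_mul, abs_of_nonneg (by positivity)]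
  gcongr
  exact abs_sourceCoeff_le hα n

/-- The explicit bound `α 2^(-α)` on the sum of the `|boxCoeff α n|` controls the minorant far from
the origin. -/
theorem hasSum_boxCoeff_bound (α : ℝ) :
    HasSum (fun n => 4 / freq n ^ 2 * (α * (1 / 2) ^ (α - 1))) (α * (1 / 2) ^ α) := by
  convert! hasSum_freq_inv_sq.mul_right (α * (1 / 2) ^ (α - 1)) using 1
  rw [← half_mul_half_rpow α]; ring

theorem summable_boxCoeff (hα : 2 ≤ α) : Summable (boxCoeff α) :=
  Summable.of_norm_bounded (hasSum_boxCoeff_bound α).summable (abs_boxCoeff_le hα)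

/-- Integrate the cosine series of the Green function against the source, term by term. -/
theorem hasSum_boxCoeff_mul_cos (hα : 2 ≤ α) {x : ℝ} (hx : x ∈ Icc (0 : ℝ) (1 / 2)) :
    HasSum (fun n => boxCoeff α n * Real.cos (freq n * x)) ((1 / 2) ^ α - x ^ α) := by
  have hc := continuous_source hα
  have h := intervalIntegral.hasSum_integral_of_dominated_convergence (μ := volume)
    (a := (0 : ℝ)) (b := 1 / 2)
    (F := fun n a => source α a * (4 / freq n ^ 2 * (Real.cos (freq n * x) * Real.cos (freq n * a))))
    (f := fun a => source α a * (1 / 2 - max x a))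
    (fun n a => 4 / freq n ^ 2 * source α a)
    (fun n => (Continuous.aestronglyMeasurable (by fun_prop)))
    (fun n => ae_of_all _ fun a ha => ?_) (ae_of_all _ fun a _ => ?_) ?_
    (ae_of_all _ fun a ha => ?_)
  · rw [integral_source_mul_green hα hx] at h
    refine h.congr_fun fun n => ?_
    rw [boxCoeff, sourceCoeff, ← intervalIntegral.integral_const_mul,
      ← intervalIntegral.integral_mul_const]
    refine intervalIntegral.integral_congr fun a _ => ?_
    ring
  · rw [uIoc_of_le (by norm_num)] at ha
    have hs := source_nonneg hα ha.1.le
    rw [norm_mul, norm_mul, norm_mul, Real.norm_of_nonneg hs, Real.norm_of_nonneg (by positivity),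
      mul_comm]
    refine mul_le_mul_of_nonneg_right (mul_le_of_le_one_right (by positivity) ?_) hs
    exact mul_le_one₀ (Real.abs_cos_le_one _) (norm_nonneg _) (Real.abs_cos_le_one _)
  · exact (hasSum_freq_inv_sq.mul_right _).summable
  · simp_rw [(hasSum_freq_inv_sq.mul_right _).tsum_eq]
    exact Continuous.intervalIntegrable (by fun_prop) _ _
  · rw [uIoc_of_le (by norm_num)] at ha
    exact (hasSum_green hx ⟨ha.1.le, ha.2⟩).mul_left _

/-- Integrate by parts with the primitive of `(-1)^n cos` that vanishes at `1/2`. Since `sin(freq n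
/ 2) = (-1)^n`, this primitive is nonpositive everywhere, while `a^s` is nondecreasing. -/
theorem integral_rpow_mul_cos_freq_nonneg {s : ℝ} (hs : 0 ≤ s) (n : ℕ) :
    0 ≤ ∫ a in (0 : ℝ)..(1 / 2), a ^ s * ((-1) ^ n * Real.cos (freq n * a)) := by
  have hw := freq_pos n
  have hInt : IntervalIntegrable (fun a : ℝ => s * a ^ (s - 1)) volume 0 (1 / 2) := by
    rcases hs.eq_or_lt with rfl | hs'
    · simp
    · exact (intervalIntegral.intervalIntegrable_rpow' (by linarith)).const_mul s
  have hparts := intervalIntegral.integral_mul_deriv_eq_deriv_mul_of_hasDeriv_right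
    (a := (0 : ℝ)) (b := 1 / 2) (u := fun a : ℝ => a ^ s) (u' := fun a => s * a ^ (s - 1))
    (v := fun a => ((-1) ^ n * Real.sin (freq n * a) - 1) / freq n)
    (v' := fun a => (-1) ^ n * Real.cos (freq n * a))
    (Real.continuous_rpow_const hs).continuousOn (Continuous.continuousOn (by fun_prop))
    (fun x hx => ?_) (fun x _ => ?_) hInt (Continuous.intervalIntegrable (by fun_prop) _ _)
  · rw [hparts, sin_freq_half, ← mul_pow]
    norm_num
    have h1 : ∫ a in (0 : ℝ)..(1 / 2), s * a ^ (s - 1)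
        * (((-1) ^ n * Real.sin (freq n * a) - 1) / freq n) ≤ 0 := by
      rw [← neg_nonneg, ← intervalIntegral.integral_neg]
      refine intervalIntegral.integral_nonneg (by norm_num) fun a ha => neg_nonneg.2 ?_
      refine mul_nonpos_of_nonneg_of_nonpos (mul_nonneg hs (Real.rpow_nonneg ha.1 _)) ?_
      refine div_nonpos_of_nonpos_of_nonneg ?_ hw.le
      have : |(-1) ^ n * Real.sin (freq n * a)| ≤ 1 := by
        rw [abs_mul, abs_pow, abs_neg, abs_one, one_pow, one_mul]
        exact Real.abs_sin_le_one _
      linarith [(abs_le.1 this).2]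
    -- The boundary term at `0` survives when `s = 0`, that is `α = 2`, because then `0 ^ s = 1`; it
    -- has the right sign.
    have h2 : 0 ≤ (0 : ℝ) ^ s * (-1 / freq n * -1) := by
      have : (0 : ℝ) ≤ -1 / freq n * -1 := by
        rw [neg_div, neg_mul_neg, mul_one]; positivity
      exact mul_nonneg (Real.rpow_nonneg le_rfl _) this
    linarith
  · rw [min_eq_left (by norm_num), max_eq_right (by norm_num)] at hx
    exact (Real.hasDerivAt_rpow_const (Or.inl hx.1.ne')).hasDerivWithinAt
  · have h1 : HasDerivAt (fun x : ℝ => freq n * x) (freq n) x := by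
      simpa using (hasDerivAt_id x).const_mul (freq n)
    have h2 := (((h1.sin).const_mul ((-1 : ℝ) ^ n)).sub_const 1).div_const (freq n)
    refine (h2.congr_deriv ?_).hasDerivWithinAt
    field_simp

/-- The sign `(-1)^n` is that of the transform of `f₁` at `n + 1/2`, as equality in the duality
requires. -/
theorem abs_boxCoeff (hα : 2 ≤ α) (n : ℕ) : |boxCoeff α n| = boxCoeff α n * (-1) ^ n := by
  have h : 0 ≤ sourceCoeff α n * (-1) ^ n := by
    have h1 := integral_rpow_mul_cos_freq_nonneg (s := α - 2) (by linarith) n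
    have h2 : sourceCoeff α n * (-1) ^ n
        = α * (α - 1) * ∫ a in (0 : ℝ)..(1 / 2), a ^ (α - 2) * ((-1) ^ n * Real.cos (freq n * a)) := by
      rw [sourceCoeff, ← intervalIntegral.integral_mul_const, ← intervalIntegral.integral_const_mul]
      refine intervalIntegral.integral_congr fun a _ => ?_
      simp only [source]
      ring
    rw [h2]
    exact mul_nonneg (mul_nonneg (by linarith) (by linarith)) h1
  have h' : 0 ≤ boxCoeff α n * (-1) ^ n := by
    rw [boxCoeff, mul_assoc]
    exact mul_nonneg (by positivity) h
  rw [← abs_of_nonneg h', abs_mul, abs_pow, abs_neg, abs_one, one_pow, mul_one]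

theorem integral_cos_freq (n : ℕ) :
    ∫ x in (0 : ℝ)..(1 / 2), Real.cos (freq n * x) = (-1) ^ n / freq n := by
  rw [intervalIntegral.integral_comp_mul_left (fun u => Real.cos u) (freq_pos n).ne', integral_cos,
    sin_freq_half, mul_zero, Real.sin_zero, sub_zero, smul_eq_mul, inv_mul_eq_div]

theorem integral_half_rpow_sub (hα : 2 ≤ α) :
    ∫ x in (0 : ℝ)..(1 / 2), ((1 / 2) ^ α - x ^ α)
      = 1 / 2 * ((1 / 2) ^ α - (1 / 2) ^ α / (α + 1)) := by
  rw [intervalIntegral.integral_sub (by simp)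
    (Continuous.intervalIntegrable (Real.continuous_rpow_const (by linarith)) _ _),
    integral_rpow (Or.inl (by linarith)), intervalIntegral.integral_const,
    Real.zero_rpow (by linarith), Real.rpow_add_one (by norm_num), smul_eq_mul]
  ring

/-- The integral of `cos(freq n x)` over `[0, 1/2]` is `(-1)^n / freq n`, so by the sign of the
coefficients the sum is `2π` times the integral of the cosine series itself. -/
theorem hasSum_abs_boxCoeff (hα : 2 ≤ α) :
    HasSum (fun n : ℕ => |boxCoeff α n| * ((n : ℝ) + 1 / 2) ^ (-1 : ℝ))
      (Real.pi * ((1 / 2) ^ α - (1 / 2) ^ α / (α + 1))) := by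
  have hpi := Real.pi_pos
  have h := intervalIntegral.hasSum_integral_of_dominated_convergence (μ := volume)
    (a := (0 : ℝ)) (b := 1 / 2)
    (F := fun n x => boxCoeff α n * Real.cos (freq n * x))
    (f := fun x => (1 / 2) ^ α - x ^ α)
    (fun n _ => |boxCoeff α n|)
    (fun n => (Continuous.aestronglyMeasurable (by fun_prop)))
    (fun n => ae_of_all _ fun a ha => ?_) (ae_of_all _ fun a _ => (summable_boxCoeff hα).abs)
    (by simp) (ae_of_all _ fun x hx => ?_)
  · rw [integral_half_rpow_sub hα] at h
    convert! h.mul_left (2 * Real.pi) using 1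
    · ext n
      have h1 : (0 : ℝ) < 2 * n + 1 := by positivity
      rw [intervalIntegral.integral_const_mul, integral_cos_freq, abs_boxCoeff hα,
        Real.rpow_neg_one, freq]
      field_simp
    · ring
  · rw [norm_mul]
    exact mul_le_of_le_one_right (abs_nonneg _) (Real.abs_cos_le_one _)
  · rw [uIoc_of_le (by norm_num)] at hx
    exact hasSum_boxCoeff_mul_cos hα ⟨hx.1.le, hx.2⟩

theorem two_mul_half_rpow_le (hα : 1 ≤ α) {x y : ℝ} (hx : 0 ≤ x) (hy : 0 ≤ y) (hxy : 1 ≤ x + y) :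
    2 * (1 / 2) ^ α ≤ x ^ α + y ^ α := by
  have h := (convexOn_rpow hα).2 (mem_Ici.2 hx) (mem_Ici.2 hy)
    (by norm_num : (0 : ℝ) ≤ 1 / 2) (by norm_num : (0 : ℝ) ≤ 1 / 2) (by norm_num)
  simp only [smul_eq_mul] at h
  have h2 : (1 / 2 : ℝ) ^ α ≤ (1 / 2 * x + 1 / 2 * y) ^ α :=
    Real.rpow_le_rpow (by norm_num) (by linarith) (by linarith)
  linarith

/-- Equality holds on `[0, 1/2]`. Up to `3/2`, antiperiodicity turns the claim into `2·2^(-α) ≤ r^α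
+ |r - 1|^α`, which is convexity. Farther out, the coefficient bound suffices. -/
theorem half_rpow_sub_tsum_le (hα : 2 ≤ α) {r : ℝ} (hr : 0 ≤ r) :
    (1 / 2) ^ α - ∑' n, boxCoeff α n * Real.cos (freq n * r) ≤ r ^ α := by
  rcases le_or_gt r (1 / 2) with h | h
  · rw [(hasSum_boxCoeff_mul_cos hα ⟨hr, h⟩).tsum_eq]; linarith
  rcases le_or_gt r (3 / 2) with h2 | h2
  · have hs := (hasSum_boxCoeff_mul_cos hα (x := |r - 1|)
      ⟨abs_nonneg _, abs_le.2 ⟨by linarith, by linarith⟩⟩).neg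
    have hs' : HasSum (fun n => boxCoeff α n * Real.cos (freq n * r))
        (-((1 / 2) ^ α - |r - 1| ^ α)) := by
      refine hs.congr_fun fun n => ?_
      have e : Real.cos (freq n * |r - 1|) = Real.cos (freq n * (r - 1)) := by
        rcases abs_choice (r - 1) with h | h <;> rw [h]
        rw [mul_neg, Real.cos_neg]
      have := cos_freq_add_one n (r - 1)
      rw [sub_add_cancel] at this
      rw [e, this]; ring
    rw [hs'.tsum_eq]
    have := two_mul_half_rpow_le (α := α) (by linarith) hr (abs_nonneg (r - 1))
      (by linarith [neg_le_abs (r - 1)])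
    linarith
  · have hb : ‖∑' n, boxCoeff α n * Real.cos (freq n * r)‖ ≤ α * (1 / 2) ^ α := by
      refine tsum_of_norm_bounded (hasSum_boxCoeff_bound α) fun n => ?_
      rw [norm_mul]
      exact (mul_le_of_le_one_right (abs_nonneg _) (Real.abs_cos_le_one _)).trans
        (abs_boxCoeff_le hα n)
    have h1 := (abs_le.1 hb).1
    have h3 : (3 / 2 : ℝ) ^ α ≤ r ^ α := Real.rpow_le_rpow (by norm_num) h2.le (by linarith)
    -- Bernoulli: `(3/2)^α = 3^α 2^(-α)` is at least `(1 + 2α) 2^(-α)`, while only `(1 + α) 2^(-α)`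
    -- is needed.
    have h4 : 1 + α * 2 ≤ (1 + 2 : ℝ) ^ α :=
      one_add_mul_self_le_rpow_one_add (by norm_num) (by linarith)
    have h5 : (3 / 2 : ℝ) ^ α = (1 + 2) ^ α * (1 / 2) ^ α := by
      rw [← Real.mul_rpow (by norm_num) (by norm_num)]; norm_num
    have h6 : (0 : ℝ) < (1 / 2) ^ α := by positivity
    have h7 : (1 + α * 2) * (1 / 2 : ℝ) ^ α ≤ (1 + 2) ^ α * (1 / 2) ^ α := by gcongr
    nlinarith

theorem C_one_line_ge (hα : 2 ≤ α) {μ : Measure ℝ} [IsFiniteMeasure μ] (hμ : μ ≠ 0) :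
    ENNReal.ofReal (1 / ((2 * Real.pi) ^ α * (α + 1))) ≤ C α 1 μ := by
  have hpi := Real.pi_pos
  have hA : (0 : ℝ) < (1 / 2) ^ α := by positivity
  have hα1 : 0 < α + 1 := by linarith
  have haA : (1 / 2 : ℝ) ^ α / (α + 1) < (1 / 2) ^ α := div_lt_self hA (by linarith)
  have key := ofReal_le_C_of_kernel (α := α) (β := 1) hμ (by linarith) one_pos (A := (1 / 2) ^ α)
    (a := (1 / 2) ^ α / (α + 1)) (by positivity) haA
    (mul_pos hpi (sub_pos.2 haA))
    (k := fun u => Real.cos (2 * Real.pi * u)) (by fun_prop) (fun x => Real.abs_cos_le_one _)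
    (fun hS ρ hρ => abs_integral_cos_le hS hρ)
    (c := boxCoeff α) (ρ := fun n : ℕ => (n : ℝ) + 1 / 2)
    (fun n => by positivity) (summable_boxCoeff hα) (hasSum_abs_boxCoeff hα) ?_
  · convert! key using 2
    have hne : (1 / 2 : ℝ) ^ α - (1 / 2) ^ α / (α + 1) ≠ 0 := (sub_pos.2 haA).ne'
    rw [Real.rpow_one, div_mul_cancel_right₀ hne, Real.mul_rpow zero_le_two hpi.le,
      Real.inv_rpow hpi.le, one_div (2 : ℝ), Real.inv_rpow zero_le_two]
    have : (0 : ℝ) < 2 ^ α := by positivity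
    have : 0 < Real.pi ^ α := by positivity
    field_simp
  · intro r hr
    have e : ∀ n : ℕ, 2 * Real.pi * (((n : ℝ) + 1 / 2) * r) = freq n * r := fun n => by
      unfold freq; ring
    simp only [e]
    exact half_rpow_sub_tsum_le hα hr

theorem f₁_eq : f₁ = (Icc (-(1 / 2) : ℝ) (1 / 2)).indicator fun _ => 1 := by
  unfold f₁; norm_num

theorem f₁_nonneg (x : ℝ) : 0 ≤ f₁ x := indicator_nonneg (fun _ _ => zero_le_one) x

theorem measurable_f₁ : Measurable f₁ := Measurable.indicator measurable_const measurableSet_Icc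

theorem integrable_f₁ : Integrable f₁ := integrable_indicator_of_continuous continuous_const

theorem f₁_mul (φ : ℝ → ℝ) :
    (fun x => f₁ x * φ x) = (Icc (-(1 / 2) : ℝ) (1 / 2)).indicator φ := by
  ext x
  simp only [f₁_eq, indicator]
  split_ifs <;> simp

theorem integral_f₁_mul {φ : ℝ → ℝ} (hφ : Continuous φ) (heven : ∀ x, φ (-x) = φ x) :
    ∫ x, f₁ x * φ x = 2 * ∫ x in (0 : ℝ)..(1 / 2), φ x := by
  rw [f₁_mul, integral_indicator_even (by norm_num) heven (hφ.intervalIntegrable _ _)]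

theorem f₁_neg (x : ℝ) : f₁ (-x) = f₁ x := by
  have : -x ∈ Icc (-(1 / 2) : ℝ) (1 / 2) ↔ x ∈ Icc (-(1 / 2) : ℝ) (1 / 2) := by
    simp only [mem_Icc]; constructor <;> rintro ⟨h1, h2⟩ <;> constructor <;> linarith
  rw [f₁_eq]
  by_cases h : x ∈ Icc (-(1 / 2) : ℝ) (1 / 2)
  · rw [indicator_of_mem h, indicator_of_mem (this.2 h)]
  · rw [indicator_of_notMem h, indicator_of_notMem (this.not.2 h)]

theorem integral_f₁ : ∫ x, f₁ x = 1 := by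
  have := integral_f₁_mul (φ := fun _ => 1) continuous_const fun _ => rfl
  simpa using this

theorem norm_fourierMeasure_f₁_mul (ξ : ℝ) :
    ‖fourierMeasure (densityMeasure f₁) ξ‖ * ‖ξ‖ ^ (1 : ℝ) = |Real.sin (Real.pi * ξ)| / Real.pi := by
  have hpi := Real.pi_pos
  rcases eq_or_ne ξ 0 with rfl | hξ
  · simp
  have e : ∀ x : ℝ, Real.cos (2 * Real.pi * inner ℝ x ξ) = Real.cos (2 * Real.pi * ξ * x) :=
    fun x => by simp only [RCLike.inner_apply, conj_trivial]; congr 1; ring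
  rw [fourierMeasure_densityMeasure f₁_nonneg measurable_f₁ integrable_f₁ f₁_neg ξ]
  simp_rw [e]
  rw [integral_f₁_mul (φ := fun x => Real.cos (2 * Real.pi * ξ * x)) (by fun_prop)
      fun x => by rw [← Real.cos_neg]; congr 1; ring,
    intervalIntegral.integral_comp_mul_left (fun u => Real.cos u) (by positivity), integral_cos,
    mul_zero, Real.sin_zero, sub_zero, smul_eq_mul, Complex.norm_real, Real.norm_eq_abs,
    Real.norm_eq_abs, Real.rpow_one, show 2 * Real.pi * ξ * (1 / 2) = Real.pi * ξ by ring,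
    abs_mul, abs_mul, abs_inv, abs_mul, abs_mul, abs_of_pos hpi, abs_two]
  have : 0 < |ξ| := abs_pos.2 hξ
  field_simp

theorem C_f₁ (hα : 2 ≤ α) :
    C α 1 (densityMeasure f₁) = ENNReal.ofReal (1 / ((2 * Real.pi) ^ α * (α + 1))) := by
  have hpi := Real.pi_pos
  have hα1 : 0 < α + 1 := by linarith
  have hcont : Continuous fun x : ℝ => ‖x‖ ^ α :=
    continuous_norm.rpow_const fun _ => Or.inr (by linarith)
  have hmom : ∫ x, f₁ x * ‖x‖ ^ α = (1 / 2) ^ α / (α + 1) := by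
    rw [integral_f₁_mul (φ := fun x => ‖x‖ ^ α) hcont fun x => by rw [norm_neg]]
    have : ∫ x in (0 : ℝ)..(1 / 2), ‖x‖ ^ α = ∫ x in (0 : ℝ)..(1 / 2), x ^ α := by
      refine intervalIntegral.integral_congr fun x hx => ?_
      rw [uIcc_of_le (by norm_num)] at hx
      simp only [Real.norm_of_nonneg hx.1]
    rw [this, integral_rpow (Or.inl (by linarith)), Real.zero_rpow (by linarith),
      Real.rpow_add_one (by norm_num)]
    ring
  have hmomint : Integrable fun x => f₁ x * ‖x‖ ^ α := by
    rw [f₁_mul]; exact integrable_indicator_of_continuous hcont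
  have hS : weightedFourierNorm 1 (densityMeasure f₁) = ENNReal.ofReal (1 / Real.pi) := by
    refine weightedFourierNorm_eq_ofReal (fun ξ => ?_) zero_le_one ⟨1 / 2, ?_⟩
    · rw [norm_fourierMeasure_f₁_mul]
      gcongr
      exact Real.abs_sin_le_one _
    · rw [norm_fourierMeasure_f₁_mul, show Real.pi * (1 / 2) = Real.pi / 2 by ring]
      simp
  rw [C_eq_ofReal (S := 1 / Real.pi) (M := (1 / 2) ^ α / (α + 1)) (m := 1) (by positivity)
    (by positivity) one_pos hS
    (by rw [moment_densityMeasure (by linarith) f₁_nonneg measurable_f₁ hmomint, hmom])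
    (by rw [densityMeasure_univ f₁_nonneg integrable_f₁, integral_f₁])]
  congr 1
  rw [Real.rpow_one, Real.one_rpow, Real.mul_rpow zero_le_two hpi.le, one_div Real.pi,
    Real.inv_rpow hpi.le, one_div (2 : ℝ), Real.inv_rpow zero_le_two]
  have : (0 : ℝ) < 2 ^ α := by positivity
  have : 0 < Real.pi ^ α := by positivity
  field_simp

end Box

/-! ### The sphere: maximum of its weighted transform and optimality -/

section SphereExtremal

/-- The function `x cos x - c sin x`, proportional to the derivative of `x ^ (-c) sin x`. -/
noncomputable def cosSin (c x : ℝ) : ℝ := x * Real.cos x - c * Real.sin x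

theorem hasDerivAt_cosSin (c x : ℝ) :
    HasDerivAt (cosSin c) (Real.cos x - x * Real.sin x - c * Real.cos x) x := by
  have h := ((hasDerivAt_id x).mul (Real.hasDerivAt_cos x)).sub
    ((Real.hasDerivAt_sin x).const_mul c)
  refine h.congr_deriv ?_
  simp only [id]; ring

theorem continuous_cosSin (c : ℝ) : Continuous (cosSin c) := by unfold cosSin; fun_prop

theorem strictConcaveOn_cosSin {c : ℝ} (hc : c < 2) :
    StrictConcaveOn ℝ (Icc 0 (Real.pi / 2)) (cosSin c) := by
  refine strictConcaveOn_of_deriv2_neg (convex_Icc _ _) (continuous_cosSin c).continuousOn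
    fun x hx => ?_
  rw [interior_Icc] at hx
  have h1 : deriv (cosSin c) = fun x => Real.cos x - x * Real.sin x - c * Real.cos x :=
    funext fun x => (hasDerivAt_cosSin c x).deriv
  have h2 : HasDerivAt (fun x => Real.cos x - x * Real.sin x - c * Real.cos x)
      (-((2 - c) * Real.sin x + x * Real.cos x)) x := by
    have h := ((Real.hasDerivAt_cos x).sub ((hasDerivAt_id x).mul (Real.hasDerivAt_sin x))).sub
      ((Real.hasDerivAt_cos x).const_mul c)
    refine h.congr_deriv ?_
    simp only [id]; ring
  rw [Function.iterate_succ, Function.iterate_one, Function.comp_apply, h1, h2.deriv, neg_lt_zero]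
  have hs : 0 < Real.sin x := Real.sin_pos_of_pos_of_lt_pi hx.1 (by linarith [hx.2, Real.pi_pos])
  have hcos : 0 < Real.cos x := Real.cos_pos_of_mem_Ioo ⟨by linarith [hx.1, Real.pi_pos], hx.2⟩
  have := mul_pos (sub_pos.2 hc) hs
  have := mul_pos hx.1 hcos
  linarith

/-- A strictly concave function vanishing at `0` has a strictly decreasing quotient by `x`. Hence
`cosSin c` changes sign at most once on `(0, π/2]`, from plus to minus; used for `c = 1 - β` and `c
= critExp / 2`. -/
theorem cosSin_mul_lt {c u v : ℝ} (hc : c < 2) (hu : 0 < u) (huv : u < v)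
    (hv : v ≤ Real.pi / 2) : u * cosSin c v < v * cosSin c u := by
  have hv0 : 0 < v := hu.trans huv
  have hquot : u / v < 1 := (div_lt_one hv0).2 huv
  have h := (strictConcaveOn_cosSin hc).2 (⟨hv0.le, hv⟩ : v ∈ Icc 0 (Real.pi / 2))
    ⟨le_rfl, Real.pi_div_two_pos.le⟩ hv0.ne' (div_pos hu hv0) (sub_pos.2 hquot) (by ring)
  simp only [smul_eq_mul, mul_zero, add_zero, div_mul_cancel₀ _ hv0.ne'] at h
  have h0 : cosSin c 0 = 0 := by simp [cosSin]
  rw [h0, mul_zero, add_zero, div_mul_eq_mul_div, div_lt_iff₀ hv0] at h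
  linarith

theorem cosSin_mul_le {c u v : ℝ} (hc : c < 2) (hu : 0 < u) (huv : u ≤ v)
    (hv : v ≤ Real.pi / 2) : u * cosSin c v ≤ v * cosSin c u := by
  rcases huv.eq_or_lt with rfl | h
  · exact le_rfl
  · exact (cosSin_mul_lt hc hu h hv).le

theorem existsUnique_cosSin_eq_zero {c : ℝ} (hc0 : 0 < c) (hc1 : c < 1) :
    ∃! x : ℝ, x ∈ Ioo 0 (Real.pi / 2) ∧ cosSin c x = 0 := by
  have hpi := Real.pi_pos
  -- Where `cos y = c`, `cosSin c y = c (y - sin y)` is positive, which starts the intermediate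
  -- value argument.
  set y := Real.arccos c
  have hy0 : 0 < y := Real.arccos_pos.2 hc1
  have hy1 : y < Real.pi / 2 := Real.arccos_lt_pi_div_two.2 hc0
  have hpos : 0 < cosSin c y := by
    rw [cosSin, Real.cos_arccos (by linarith) hc1.le]
    have := mul_lt_mul_of_pos_left (Real.sin_lt hy0) hc0
    linarith
  have hneg : cosSin c (Real.pi / 2) < 0 := by simp [cosSin, hc0]
  obtain ⟨x, hx, hx0⟩ := intermediate_value_Icc' hy1.le (continuous_cosSin c).continuousOn
    (show (0 : ℝ) ∈ Icc _ _ from ⟨hneg.le, hpos.le⟩)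
  have hxlt : x < Real.pi / 2 := lt_of_le_of_ne hx.2 (by rintro rfl; linarith)
  refine ⟨x, ⟨⟨hy0.trans_le hx.1, hxlt⟩, hx0⟩, ?_⟩
  rintro z ⟨hz, hz0⟩
  rcases lt_trichotomy z x with h | h | h
  · have := cosSin_mul_lt (c := c) (by linarith) hz.1 h hxlt.le
    rw [hx0, hz0] at this; simp at this
  · exact h
  · have := cosSin_mul_lt (c := c) (by linarith) (hy0.trans_le hx.1) h hz.2.le
    rw [hx0, hz0] at this; simp at this

theorem tan_equation_iff {c x : ℝ} (hx : x ∈ Ioo 0 (Real.pi / 2)) :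
    x = c * Real.tan x ↔ cosSin c x = 0 := by
  have hcos : 0 < Real.cos x := Real.cos_pos_of_mem_Ioo ⟨by linarith [hx.1, Real.pi_pos], hx.2⟩
  rw [Real.tan_eq_sin_div_cos, ← mul_div_assoc, eq_div_iff hcos.ne', cosSin, sub_eq_zero]

theorem existsUnique_isLambda {β : ℝ} (hβ0 : 0 < β) (hβ1 : β ≤ 1) : ∃! l : ℝ, IsLambda β l := by
  have hpi := Real.pi_pos
  rcases hβ1.eq_or_lt with rfl | hβ
  · refine ⟨1 / 4, Or.inl ⟨rfl, rfl⟩, ?_⟩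
    rintro l (⟨-, h⟩ | ⟨h, -⟩)
    · exact h
    · exact absurd h (lt_irrefl _)
  obtain ⟨x, ⟨hx, hx0⟩, huniq⟩ := existsUnique_cosSin_eq_zero (c := 1 - β) (by linarith)
    (by linarith)
  have hx' : 2 * Real.pi * (x / (2 * Real.pi)) = x := by field_simp
  refine ⟨x / (2 * Real.pi), Or.inr ⟨hβ, ⟨div_pos hx.1 (by positivity), ?_⟩, ?_⟩, ?_⟩
  · rw [div_lt_iff₀ (by positivity)]; linarith [hx.2]
  · rw [hx']; exact (tan_equation_iff hx).2 hx0
  · rintro l (⟨h, -⟩ | ⟨-, hl, h⟩)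
    · exact absurd h hβ.ne
    · have hl' : 2 * Real.pi * l ∈ Ioo 0 (Real.pi / 2) :=
        ⟨mul_pos (by positivity) hl.1, by nlinarith [hl.2]⟩
      have := huniq _ ⟨hl', (tan_equation_iff hl').1 h⟩
      rw [← this]; field_simp

/-- The angle `2πλ` attached to the optimal frequency. -/
theorem IsLambda.angle {β l : ℝ} (h : IsLambda β l) :
    2 * Real.pi * l ∈ Ioc 0 (Real.pi / 2) ∧ cosSin (1 - β) (2 * Real.pi * l) = 0 := by
  have hpi := Real.pi_pos
  rcases h with ⟨rfl, rfl⟩ | ⟨-, hl, h⟩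
  · rw [show 2 * Real.pi * (1 / 4) = Real.pi / 2 by ring]
    exact ⟨⟨by positivity, le_rfl⟩, by simp [cosSin]⟩
  · have hl' : 2 * Real.pi * l ∈ Ioo 0 (Real.pi / 2) :=
      ⟨mul_pos (by positivity) hl.1, by nlinarith [hl.2]⟩
    exact ⟨⟨hl'.1, hl'.2.le⟩, (tan_equation_iff hl').1 h⟩

theorem hasDerivAt_sin_mul_rpow (c : ℝ) {x : ℝ} (hx : 0 < x) :
    HasDerivAt (fun x => Real.sin x * x ^ (-c)) (x ^ (-c - 1) * cosSin c x) x := by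
  have h := (Real.hasDerivAt_sin x).mul
    (Real.hasDerivAt_rpow_const (x := x) (p := -c) (Or.inl hx.ne'))
  refine h.congr_deriv ?_
  have : x ^ (-c) = x ^ (-c - 1) * x := by
    rw [Real.rpow_sub_one hx.ne']; field_simp
  rw [this, cosSin]; ring

/-- The maximum of `|sin x| x ^ (-c)` on the positive half-line. -/
theorem abs_sin_mul_rpow_le {c θ : ℝ} (hc0 : 0 ≤ c) (hc1 : c < 1) (hθ : θ ∈ Ioc 0 (Real.pi / 2))
    (hθ0 : cosSin c θ = 0) {x : ℝ} (hx : 0 < x) :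
    |Real.sin x| * x ^ (-c) ≤ Real.sin θ * θ ^ (-c) := by
  have hpi := Real.pi_pos
  have hcont : ContinuousOn (fun x => Real.sin x * x ^ (-c)) (Ioi 0) := fun x hx =>
    (hasDerivAt_sin_mul_rpow c hx).continuousAt.continuousWithinAt
  have hright : ∀ x ∈ Icc θ (Real.pi / 2), Real.sin x * x ^ (-c) ≤ Real.sin θ * θ ^ (-c) := by
    intro x hx
    have hanti : AntitoneOn (fun x => Real.sin x * x ^ (-c)) (Icc θ (Real.pi / 2)) := by
      refine antitoneOn_of_hasDerivWithinAt_nonpos (convex_Icc _ _)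
        (hcont.mono fun y hy => hθ.1.trans_le hy.1)
        (f' := fun x => x ^ (-c - 1) * cosSin c x) (fun y hy => ?_) fun y hy => ?_
      · rw [interior_Icc] at hy
        exact (hasDerivAt_sin_mul_rpow c (hθ.1.trans hy.1)).hasDerivWithinAt
      · rw [interior_Icc] at hy
        have hy0 := hθ.1.trans hy.1
        have h := cosSin_mul_le (c := c) (by linarith) hθ.1 hy.1.le hy.2.le
        rw [hθ0, mul_zero] at h
        have : cosSin c y ≤ 0 := nonpos_of_mul_nonpos_right h hθ.1
        exact mul_nonpos_of_nonneg_of_nonpos (Real.rpow_nonneg hy0.le _) this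
    exact hanti ⟨le_rfl, hθ.2⟩ hx hx.1
  rcases le_or_gt x (Real.pi / 2) with h | h
  · rw [abs_of_nonneg (Real.sin_nonneg_of_nonneg_of_le_pi hx.le (by linarith))]
    rcases le_total x θ with h' | h'
    · have hmono : MonotoneOn (fun x => Real.sin x * x ^ (-c)) (Icc x θ) := by
        refine monotoneOn_of_hasDerivWithinAt_nonneg (convex_Icc _ _)
          (hcont.mono fun y hy => hx.trans_le hy.1)
          (f' := fun x => x ^ (-c - 1) * cosSin c x) (fun y hy => ?_) fun y hy => ?_
        · rw [interior_Icc] at hy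
          exact (hasDerivAt_sin_mul_rpow c (hx.trans hy.1)).hasDerivWithinAt
        · rw [interior_Icc] at hy
          have hy0 := hx.trans hy.1
          have h := cosSin_mul_le (c := c) (by linarith) hy0 hy.2.le hθ.2
          rw [hθ0, mul_zero] at h
          have : 0 ≤ cosSin c y := nonneg_of_mul_nonneg_right h hθ.1
          exact mul_nonneg (Real.rpow_nonneg hy0.le _) this
      exact hmono ⟨le_rfl, h'⟩ ⟨h', le_rfl⟩ h'
    · exact hright x ⟨h', h⟩
  -- Beyond `π/2`, both `|sin x| ≤ 1` and `x^(-c)` are dominated by their values at `π/2`.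
  · refine le_trans ?_ (hright (Real.pi / 2) ⟨hθ.2, le_rfl⟩)
    rw [Real.sin_pi_div_two]
    exact mul_le_mul (Real.abs_sin_le_one _)
      (Real.rpow_le_rpow_of_nonpos (by positivity) h.le (by linarith))
      (Real.rpow_nonneg hx.le _) zero_le_one

theorem norm_fourierMeasure_μ₄_mul {β : ℝ} {ξ : E3} (hξ : ξ ≠ 0) :
    ‖fourierMeasure μ₄ ξ‖ * ‖ξ‖ ^ β
      = 4 * Real.pi * (2 * Real.pi) ^ (-β)
        * (|Real.sin (2 * Real.pi * ‖ξ‖)| * (2 * Real.pi * ‖ξ‖) ^ (-(1 - β))) := by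
  have hpi := Real.pi_pos
  have hn : 0 < ‖ξ‖ := norm_pos_iff.2 hξ
  have hs : 0 < 2 * Real.pi * ‖ξ‖ := by positivity
  rw [fourierMeasure_μ₄, Complex.norm_real, Real.norm_eq_abs, abs_mul,
    abs_of_pos (by positivity : 0 < 4 * Real.pi), Real.sinc_of_ne_zero hs.ne', abs_div,
    abs_of_pos hs, neg_sub, Real.rpow_sub_one hs.ne', Real.mul_rpow (by positivity) hn.le,
    Real.rpow_neg (by positivity)]
  have : (0 : ℝ) < (2 * Real.pi) ^ β := by positivity
  field_simp

theorem weightedFourierNorm_μ₄ {β l : ℝ} (hβ0 : 0 < β) (hβ1 : β ≤ 1) (hl : IsLambda β l) :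
    weightedFourierNorm β μ₄
      = ENNReal.ofReal (4 * Real.pi * (Real.sinc (2 * Real.pi * l) * l ^ β)) := by
  have hpi := Real.pi_pos
  obtain ⟨hθ, hθ0⟩ := hl.angle
  have hl0 : 0 < l := pos_of_mul_pos_right hθ.1 (by positivity)
  have hnorm : ‖(EuclideanSpace.single 0 l : E3)‖ = l := by
    rw [PiLp.norm_single, Real.norm_of_nonneg hl0.le]
  have hne : (EuclideanSpace.single 0 l : E3) ≠ 0 := by
    rw [← norm_pos_iff, hnorm]; exact hl0
  have hsin : 0 ≤ Real.sin (2 * Real.pi * l) :=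
    Real.sin_nonneg_of_nonneg_of_le_pi hθ.1.le (by linarith [hθ.2])
  have hval : ‖fourierMeasure μ₄ (EuclideanSpace.single 0 l : E3)‖
      * ‖(EuclideanSpace.single 0 l : E3)‖ ^ β
      = 4 * Real.pi * (Real.sinc (2 * Real.pi * l) * l ^ β) := by
    rw [fourierMeasure_μ₄, hnorm, Complex.norm_real, Real.norm_of_nonneg, mul_assoc]
    rw [Real.sinc_of_ne_zero hθ.1.ne']
    exact mul_nonneg (by positivity) (div_nonneg hsin hθ.1.le)
  refine weightedFourierNorm_eq_ofReal (fun ξ => ?_) hβ0.le ⟨_, hval⟩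
  rw [← hval]
  rcases eq_or_ne ξ 0 with rfl | hξ
  · rw [norm_zero (E := E3), Real.zero_rpow hβ0.ne', mul_zero]; positivity
  rw [norm_fourierMeasure_μ₄_mul hξ, norm_fourierMeasure_μ₄_mul hne, hnorm]
  refine mul_le_mul_of_nonneg_left ?_ (by positivity)
  rw [abs_of_nonneg hsin]
  exact abs_sin_mul_rpow_le (by linarith) (by linarith) hθ hθ0
    (by have := norm_pos_iff.2 hξ; positivity)

/-! ### The minorant of the weight -/

theorem mul_cos_le_sin {x : ℝ} (hx : x ∈ Icc 0 Real.pi) : x * Real.cos x ≤ Real.sin x := by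
  have hanti : AntitoneOn (cosSin 1) (Icc 0 Real.pi) := by
    refine antitoneOn_of_hasDerivWithinAt_nonpos (convex_Icc _ _) (continuous_cosSin 1).continuousOn
      (fun y _ => (hasDerivAt_cosSin 1 y).hasDerivWithinAt) fun y hy => ?_
    rw [interior_Icc] at hy
    have := mul_nonneg hy.1.le (Real.sin_nonneg_of_nonneg_of_le_pi hy.1.le hy.2.le)
    linarith
  have := hanti ⟨le_rfl, Real.pi_pos.le⟩ hx hx.1
  simp only [cosSin] at this
  simp at this
  linarith

/-- The function `(sin x - x cos x) / x³`, minus the derivative of `sinc` divided by `x`. -/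
noncomputable def besselRatio (x : ℝ) : ℝ := (Real.sin x - x * Real.cos x) / x ^ 3

/-- The numerator of the derivative vanishes at `0` and has derivative `y (y cos y - sin y)`, which
is nonpositive on `[0, π]`. -/
theorem antitoneOn_besselRatio : AntitoneOn besselRatio (Ioc 0 Real.pi) := by
  have hder : ∀ x : ℝ, x ≠ 0 → HasDerivAt besselRatio
      ((x ^ 2 * Real.sin x - 3 * Real.sin x + 3 * x * Real.cos x) / x ^ 4) x := fun x hx => by
    have h := ((Real.hasDerivAt_sin x).sub ((hasDerivAt_id x).mul (Real.hasDerivAt_cos x))).div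
      (hasDerivAt_pow 3 x) (pow_ne_zero 3 hx)
    refine h.congr_deriv ?_
    simp only [id, Pi.sub_apply, Pi.mul_apply]
    field_simp
    ring
  have hN : ∀ x ∈ Icc 0 Real.pi,
      x ^ 2 * Real.sin x - 3 * Real.sin x + 3 * x * Real.cos x ≤ 0 := by
    have hanti : AntitoneOn (fun x => x ^ 2 * Real.sin x - 3 * Real.sin x + 3 * x * Real.cos x)
        (Icc 0 Real.pi) := by
      refine antitoneOn_of_hasDerivWithinAt_nonpos (convex_Icc _ _)
        (Continuous.continuousOn (by fun_prop))
        (f' := fun y => y * (y * Real.cos y - Real.sin y)) (fun y _ => ?_) fun y hy => ?_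
      · have h := (((hasDerivAt_pow 2 y).mul (Real.hasDerivAt_sin y)).sub
          ((Real.hasDerivAt_sin y).const_mul 3)).add
          (((hasDerivAt_id y).const_mul 3).mul (Real.hasDerivAt_cos y))
        refine (h.congr_deriv ?_).hasDerivWithinAt
        simp only [id]
        push_cast
        ring
      · rw [interior_Icc] at hy
        exact mul_nonpos_of_nonneg_of_nonpos hy.1.le
          (by linarith [mul_cos_le_sin ⟨hy.1.le, hy.2.le⟩])
    intro x hx
    have := hanti ⟨le_rfl, Real.pi_pos.le⟩ hx hx.1
    simpa using this
  refine antitoneOn_of_hasDerivWithinAt_nonpos (convex_Ioc _ _)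
    (fun x hx => (hder x hx.1.ne').continuousAt.continuousWithinAt)
    (fun x hx => (hder x ?_).hasDerivWithinAt) fun x hx => ?_
  · rw [interior_Ioc] at hx; exact hx.1.ne'
  · rw [interior_Ioc] at hx
    exact div_nonpos_of_nonpos_of_nonneg (hN x ⟨hx.1.le, hx.2.le⟩) (by positivity)

theorem besselRatio_ge {θ : ℝ} (hθ : θ ∈ Ioc 0 (Real.pi / 2)) :
    8 / Real.pi ^ 3 ≤ besselRatio θ := by
  have hpi := Real.pi_pos
  have h := antitoneOn_besselRatio ⟨hθ.1, by linarith [hθ.2]⟩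
    (⟨by positivity, by linarith⟩ : Real.pi / 2 ∈ Ioc 0 Real.pi) hθ.2
  refine le_trans (le_of_eq ?_) h
  simp only [besselRatio, Real.sin_pi_div_two, Real.cos_pi_div_two]
  field_simp
  norm_num

/-- Monotonicity covers `x ≤ π`. Beyond, the crude bound `2/x²` is below `8/π³ = besselRatio (π/2)`,
since `π < 4`. -/
theorem besselRatio_le {θ x : ℝ} (hθ : θ ∈ Ioc 0 (Real.pi / 2)) (hx : θ ≤ x) :
    besselRatio x ≤ besselRatio θ := by
  have hpi := Real.pi_gt_three
  have hx0 : 0 < x := hθ.1.trans_le hx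
  rcases le_or_gt x Real.pi with h | h
  · exact antitoneOn_besselRatio ⟨hθ.1, by linarith [hθ.2]⟩ ⟨hx0, h⟩ hx
  · refine le_trans ?_ (besselRatio_ge hθ)
    have h1 : Real.sin x - x * Real.cos x ≤ 2 * x := by
      nlinarith [Real.sin_le_one x, Real.neg_one_le_cos x]
    rw [besselRatio, div_le_div_iff₀ (by positivity) (by positivity)]
    have h2 : Real.pi ^ 2 ≤ x ^ 2 := by gcongr
    have h3 : Real.pi ^ 3 ≤ 4 * x ^ 2 := by
      nlinarith [Real.pi_lt_four, sq_nonneg Real.pi]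
    calc (Real.sin x - x * Real.cos x) * Real.pi ^ 3 ≤ 2 * x * Real.pi ^ 3 := by gcongr
      _ ≤ 2 * x * (4 * x ^ 2) := by gcongr
      _ = 8 * x ^ 3 := by ring

theorem hasDerivAt_sinc {x : ℝ} (hx : x ≠ 0) :
    HasDerivAt Real.sinc (-(x * besselRatio x)) x := by
  have h := (Real.hasDerivAt_sin x).div (hasDerivAt_id x) hx
  have h' : HasDerivAt Real.sinc ((Real.cos x * x - Real.sin x * 1) / x ^ 2) x := by
    refine h.congr_of_eventuallyEq ?_
    filter_upwards [isOpen_ne.mem_nhds hx] with y hy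
    exact Real.sinc_of_ne_zero hy
  refine h'.congr_deriv ?_
  rw [besselRatio]
  field_simp
  ring

theorem sinc_sub_cos {θ : ℝ} (hθ : 0 < θ) :
    Real.sinc θ - Real.cos θ = θ ^ 2 * besselRatio θ := by
  rw [Real.sinc_of_ne_zero hθ.ne', besselRatio]
  field_simp

/-- The sharp quadratic lower bound for `sinc`. -/
theorem sinc_sub_sinc_le {θ : ℝ} (hθ : θ ∈ Ioc 0 (Real.pi / 2)) {x : ℝ} (hx : 0 ≤ x) :
    Real.sinc θ - Real.sinc x ≤ besselRatio θ / 2 * (x ^ 2 - θ ^ 2) := by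
  have hpi := Real.pi_pos
  -- Its derivative is `y (besselRatio θ - besselRatio y)`, so `H` has its minimum on the half-line
  -- at `θ`.
  set H : ℝ → ℝ := fun x => besselRatio θ / 2 * x ^ 2 + Real.sinc x with hH
  have hcont : Continuous H := by fun_prop
  have hder : ∀ y : ℝ, 0 < y → HasDerivAt H (y * (besselRatio θ - besselRatio y)) y := fun y hy => by
    have h := ((hasDerivAt_pow 2 y).const_mul (besselRatio θ / 2)).add (hasDerivAt_sinc hy.ne')
    refine h.congr_deriv ?_
    push_cast
    ring
  suffices h : H θ ≤ H x by simp only [hH] at h; linarith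
  rcases le_total x θ with h | h
  · have hanti : AntitoneOn H (Icc 0 θ) := by
      refine antitoneOn_of_hasDerivWithinAt_nonpos (convex_Icc _ _) hcont.continuousOn
        (f' := fun y => y * (besselRatio θ - besselRatio y)) (fun y hy => ?_) fun y hy => ?_
      · rw [interior_Icc] at hy; exact (hder y hy.1).hasDerivWithinAt
      · rw [interior_Icc] at hy
        refine mul_nonpos_of_nonneg_of_nonpos hy.1.le (sub_nonpos.2 ?_)
        exact besselRatio_le ⟨hy.1, hy.2.le.trans hθ.2⟩ hy.2.le
    exact hanti ⟨hx, h⟩ ⟨hθ.1.le, le_rfl⟩ h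
  · have hmono : MonotoneOn H (Ici θ) := by
      refine monotoneOn_of_hasDerivWithinAt_nonneg (convex_Ici _) hcont.continuousOn
        (f' := fun y => y * (besselRatio θ - besselRatio y)) (fun y hy => ?_) fun y hy => ?_
      · rw [interior_Ici] at hy; exact (hder y (hθ.1.trans hy)).hasDerivWithinAt
      · rw [interior_Ici] at hy
        exact mul_nonneg (hθ.1.trans hy).le (sub_nonneg.2 (besselRatio_le hθ (le_of_lt hy)))
    exact hmono self_mem_Ici h h

/-- Monotonicity of `(r^α - 1)/α` in `α`. -/
theorem rpow_sub_one_mul_le {α α₀ r : ℝ} (hα₀ : 0 < α₀) (hα : α₀ ≤ α) (hr : 0 ≤ r) :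
    α / α₀ * (r ^ α₀ - 1) ≤ r ^ α - 1 := by
  have h := one_add_mul_self_le_rpow_one_add (s := r ^ α₀ - 1)
    (by linarith [Real.rpow_nonneg hr α₀]) ((one_le_div hα₀).2 hα)
  rw [add_sub_cancel, ← Real.rpow_mul hr, mul_div_cancel₀ _ hα₀.ne'] at h
  linarith

/-- The coefficient `α / (sinc θ - cos θ)` is the one for which both sides are tangent at `r = 1`.
The case `α = 2` is the quadratic bound for `sinc` at `θ r`, and larger `α` follow by Bernoulli. -/
theorem minorant_two {α θ r : ℝ} (hα : 2 ≤ α) (hθ : θ ∈ Ioc 0 (Real.pi / 2)) (hr : 0 ≤ r) :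
    1 + α / (Real.sinc θ - Real.cos θ) * Real.sinc θ
      - α / (Real.sinc θ - Real.cos θ) * Real.sinc (θ * r) ≤ r ^ α := by
  have hb : 0 < besselRatio θ :=
    lt_of_lt_of_le (by have := Real.pi_pos; positivity) (besselRatio_ge hθ)
  have h1 := sinc_sub_sinc_le hθ (x := θ * r) (mul_nonneg hθ.1.le hr)
  have h2 := rpow_sub_one_mul_le two_pos hα hr
  rw [Real.rpow_ofNat] at h2
  rw [sinc_sub_cos hθ.1]
  have hpos : 0 < α / (θ ^ 2 * besselRatio θ) := by have := hθ.1; positivity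
  have h3 := mul_le_mul_of_nonneg_left h1 hpos.le
  have h4 : α / (θ ^ 2 * besselRatio θ) * (besselRatio θ / 2 * ((θ * r) ^ 2 - θ ^ 2))
      = α / 2 * (r ^ 2 - 1) := by
    have := hθ.1.ne'
    field_simp
  rw [h4] at h3
  linarith

/-! ### The critical exponent for `β = 1` -/

/-- The critical exponent `(π/2 - 1)⁻¹`. -/
noncomputable def critExp : ℝ := (Real.pi / 2 - 1)⁻¹

theorem critExp_mul : critExp * (Real.pi / 2 - 1) = 1 :=
  inv_mul_cancel₀ (by linarith [Real.pi_gt_three])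

theorem critExp_lt_two : critExp < 2 := by
  have h : (1 / 2 : ℝ) < Real.pi / 2 - 1 := by linarith [Real.pi_gt_three]
  calc critExp < (1 / 2 : ℝ)⁻¹ := inv_strictAnti₀ (by norm_num) h
    _ = 2 := by norm_num

theorem pi_div_two_lt_critExp : Real.pi / 2 < critExp := by
  rw [critExp, lt_inv_comm₀ (by positivity) (by linarith [Real.pi_gt_three]),
    lt_inv_comm₀ (by linarith [Real.pi_gt_three]) (by positivity), ← one_div,
    lt_div_iff₀ (by linarith [Real.pi_gt_three])]
  nlinarith [Real.pi_lt_d2, Real.pi_gt_three]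

/-- The function governing the monotonicity of `(x - sin x) / x ^ (critExp + 1)`. -/
noncomputable def critAux (x : ℝ) : ℝ :=
  (1 + critExp) * Real.sin x - x * Real.cos x - critExp * x

theorem hasDerivAt_critAux (x : ℝ) :
    HasDerivAt critAux (4 * Real.sin (x / 2) * cosSin (critExp / 2) (x / 2)) x := by
  have h := (((Real.hasDerivAt_sin x).const_mul (1 + critExp)).sub
    ((hasDerivAt_id x).mul (Real.hasDerivAt_cos x))).sub ((hasDerivAt_id x).const_mul critExp)
  refine h.congr_deriv ?_
  simp only [id, cosSin]
  have h1 : Real.sin x = 2 * Real.sin (x / 2) * Real.cos (x / 2) := by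
    rw [← Real.sin_two_mul]; ring_nf
  have h2 : Real.cos x = 1 - 2 * Real.sin (x / 2) ^ 2 := by
    rw [← Real.cos_sq_add_sin_sq (x / 2)]
    have := Real.cos_two_mul' (x / 2)
    rw [mul_div_cancel₀ _ two_ne_zero] at this
    linarith
  rw [h1, h2]
  ring

theorem continuous_critAux : Continuous critAux := by unfold critAux; fun_prop

theorem critAux_zero : critAux 0 = 0 := by simp [critAux]

/-- This equation determines `critExp`. -/
theorem critAux_pi_div_two : critAux (Real.pi / 2) = 0 := by
  simp only [critAux, Real.sin_pi_div_two, Real.cos_pi_div_two]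
  linarith [critExp_mul]

/-- `critAux` vanishes at `0` and `π/2`, and its derivative changes sign at most once in between,
from plus to minus. So it either increases from `0` up to `x` or decreases from `x` down to `0`. -/
theorem critAux_nonneg {x : ℝ} (hx : x ∈ Ioc 0 (Real.pi / 2)) : 0 ≤ critAux x := by
  have hpi := Real.pi_pos
  have hc : critExp / 2 < 2 := by linarith [critExp_lt_two]
  have hx2 : 0 < x / 2 := by linarith [hx.1]
  rcases le_total 0 (cosSin (critExp / 2) (x / 2)) with h | h
  · have hmono : MonotoneOn critAux (Icc 0 x) := by
      refine monotoneOn_of_hasDerivWithinAt_nonneg (convex_Icc _ _) continuous_critAux.continuousOn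
        (fun y _ => (hasDerivAt_critAux y).hasDerivWithinAt) fun y hy => ?_
      rw [interior_Icc] at hy
      have h1 := cosSin_mul_le hc (u := y / 2) (v := x / 2) (by linarith [hy.1])
        (by linarith [hy.2]) (by linarith [hx.2])
      have h2 : 0 ≤ x / 2 * cosSin (critExp / 2) (y / 2) :=
        le_trans (mul_nonneg (by linarith [hy.1]) h) h1
      have h3 := nonneg_of_mul_nonneg_right h2 hx2
      have h4 := Real.sin_nonneg_of_nonneg_of_le_pi (x := y / 2) (by linarith [hy.1])
        (by linarith [hy.2, hx.2])
      positivity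
    have := hmono ⟨le_rfl, hx.1.le⟩ ⟨hx.1.le, le_rfl⟩ hx.1.le
    rwa [critAux_zero] at this
  · have hanti : AntitoneOn critAux (Icc x (Real.pi / 2)) := by
      refine antitoneOn_of_hasDerivWithinAt_nonpos (convex_Icc _ _) continuous_critAux.continuousOn
        (fun y _ => (hasDerivAt_critAux y).hasDerivWithinAt) fun y hy => ?_
      rw [interior_Icc] at hy
      have h1 := cosSin_mul_le hc (u := x / 2) (v := y / 2) hx2
        (by linarith [hy.1]) (by linarith [hy.2])
      have h2 : x / 2 * cosSin (critExp / 2) (y / 2) ≤ 0 :=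
        le_trans h1 (mul_nonpos_of_nonneg_of_nonpos (by linarith [hy.1, hx.1]) h)
      have h3 := nonpos_of_mul_nonpos_right h2 hx2
      have h4 := Real.sin_nonneg_of_nonneg_of_le_pi (x := y / 2) (by linarith [hy.1, hx.1])
        (by linarith [hy.2])
      exact mul_nonpos_of_nonneg_of_nonpos (by positivity) h3
    have := hanti ⟨le_rfl, hx.2⟩ ⟨hx.2, le_rfl⟩ hx.2
    rwa [critAux_pi_div_two] at this

/-- On `[π/2, π]` the function decreases from `0`, because `critExp > π/2` makes `cosSin (critExp /
2)` nonpositive from `π/4` on. On `[π, 2π]` the sine is nonpositive and `critExp > 1`. Beyond, the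
linear term dominates: `1 + critExp ≤ 6 (critExp - 1)`. -/
theorem critAux_nonpos {x : ℝ} (hx : Real.pi / 2 ≤ x) : critAux x ≤ 0 := by
  have hpi := Real.pi_gt_three
  have hc : critExp / 2 < 2 := by linarith [critExp_lt_two]
  have hcrit := pi_div_two_lt_critExp
  rcases le_total x Real.pi with h | h
  · have h0 : cosSin (critExp / 2) (Real.pi / 4) ≤ 0 := by
      rw [cosSin, Real.sin_pi_div_four, Real.cos_pi_div_four, ← sub_mul]
      exact mul_nonpos_of_nonpos_of_nonneg (by linarith) (by positivity)
    have hanti : AntitoneOn critAux (Icc (Real.pi / 2) Real.pi) := by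
      refine antitoneOn_of_hasDerivWithinAt_nonpos (convex_Icc _ _) continuous_critAux.continuousOn
        (fun y _ => (hasDerivAt_critAux y).hasDerivWithinAt) fun y hy => ?_
      rw [interior_Icc] at hy
      have h1 := cosSin_mul_le hc (u := Real.pi / 4) (v := y / 2) (by positivity)
        (by linarith [hy.1]) (by linarith [hy.2])
      have h2 : Real.pi / 4 * cosSin (critExp / 2) (y / 2) ≤ 0 :=
        le_trans h1 (mul_nonpos_of_nonneg_of_nonpos (by linarith [hy.1]) h0)
      have h3 := nonpos_of_mul_nonpos_right h2 (by positivity)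
      have h4 := Real.sin_nonneg_of_nonneg_of_le_pi (x := y / 2) (by linarith [hy.1])
        (by linarith [hy.2])
      exact mul_nonpos_of_nonneg_of_nonpos (by positivity) h3
    have := hanti ⟨le_rfl, by linarith⟩ ⟨hx, h⟩ hx
    rwa [critAux_pi_div_two] at this
  have hcos := Real.neg_one_le_cos x
  have e : critAux x = (1 + critExp) * Real.sin x - x * (critExp + Real.cos x) := by
    unfold critAux; ring
  rw [e]
  rcases le_total x (2 * Real.pi) with h2 | h2
  · have hs : Real.sin x ≤ 0 := by
      have := Real.sin_nonneg_of_nonneg_of_le_pi (x := x - Real.pi) (by linarith) (by linarith)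
      rw [Real.sin_sub_pi] at this
      linarith
    have h3 : (1 + critExp) * Real.sin x ≤ 0 :=
      mul_nonpos_of_nonneg_of_nonpos (by linarith) hs
    have h4 : 0 ≤ x * (critExp + Real.cos x) := mul_nonneg (by linarith) (by linarith)
    linarith
  · have h3 : (1 + critExp) * Real.sin x ≤ (1 + critExp) * 1 :=
      mul_le_mul_of_nonneg_left (Real.sin_le_one x) (by linarith)
    have h4 : 6 * (critExp - 1) ≤ x * (critExp + Real.cos x) :=
      mul_le_mul (by linarith) (by linarith) (by linarith) (by linarith)
    linarith

theorem hasDerivAt_sub_sin_mul_rpow {x : ℝ} (hx : 0 < x) :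
    HasDerivAt (fun x => (x - Real.sin x) * x ^ (-(critExp + 1)))
      (x ^ (-(critExp + 1) - 1) * critAux x) x := by
  have h := ((hasDerivAt_id x).sub (Real.hasDerivAt_sin x)).mul
    (Real.hasDerivAt_rpow_const (x := x) (p := -(critExp + 1)) (Or.inl hx.ne'))
  refine h.congr_deriv ?_
  have : x ^ (-(critExp + 1)) = x ^ (-(critExp + 1) - 1) * x := by
    rw [Real.rpow_sub_one hx.ne']; field_simp
  simp only [id, Pi.sub_apply]
  rw [this, critAux]; ring

/-- The derivative has the sign of `critAux`, so the maximum is at `π/2`. -/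
theorem sub_sin_mul_rpow_le {x : ℝ} (hx : 0 < x) :
    (x - Real.sin x) * x ^ (-(critExp + 1))
      ≤ (Real.pi / 2 - 1) * (Real.pi / 2) ^ (-(critExp + 1)) := by
  have hpi := Real.pi_pos
  set Q : ℝ → ℝ := fun x => (x - Real.sin x) * x ^ (-(critExp + 1)) with hQ
  have hcont : ContinuousOn Q (Ioi 0) := fun x hx =>
    (hasDerivAt_sub_sin_mul_rpow hx).continuousAt.continuousWithinAt
  suffices h : Q x ≤ Q (Real.pi / 2) by simpa only [hQ, Real.sin_pi_div_two] using h
  rcases le_total x (Real.pi / 2) with h | h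
  · have hmono : MonotoneOn Q (Icc x (Real.pi / 2)) := by
      refine monotoneOn_of_hasDerivWithinAt_nonneg (convex_Icc _ _)
        (hcont.mono fun y hy => hx.trans_le hy.1)
        (f' := fun x => x ^ (-(critExp + 1) - 1) * critAux x) (fun y hy => ?_) fun y hy => ?_
      · rw [interior_Icc] at hy
        exact (hasDerivAt_sub_sin_mul_rpow (hx.trans hy.1)).hasDerivWithinAt
      · rw [interior_Icc] at hy
        exact mul_nonneg (Real.rpow_nonneg (hx.trans hy.1).le _)
          (critAux_nonneg ⟨hx.trans hy.1, hy.2.le⟩)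
    exact hmono ⟨le_rfl, h⟩ ⟨h, le_rfl⟩ h
  · have hanti : AntitoneOn Q (Ici (Real.pi / 2)) := by
      refine antitoneOn_of_hasDerivWithinAt_nonpos (convex_Ici _)
        (hcont.mono fun y hy => Real.pi_div_two_pos.trans_le hy)
        (f' := fun x => x ^ (-(critExp + 1) - 1) * critAux x) (fun y hy => ?_) fun y hy => ?_
      · rw [interior_Ici] at hy
        exact (hasDerivAt_sub_sin_mul_rpow (Real.pi_div_two_pos.trans hy)).hasDerivWithinAt
      · rw [interior_Ici] at hy
        exact mul_nonpos_of_nonneg_of_nonpos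
          (Real.rpow_nonneg (le_of_lt (Real.pi_div_two_pos.trans hy)) _)
          (critAux_nonpos (le_of_lt hy))
    exact hanti self_mem_Ici h h

/-- The preceding maximum at `x = πr/2`, rescaled using `1 + critExp = critExp π/2`. It is the
minorant at the critical exponent itself. -/
theorem one_sub_sinc_le {r : ℝ} (hr : 0 ≤ r) :
    (1 + critExp) * (1 - Real.sinc (Real.pi / 2 * r)) ≤ r ^ critExp := by
  have hpi := Real.pi_pos
  have hcrit : 0 < critExp := lt_trans (by positivity) pi_div_two_lt_critExp
  rcases hr.eq_or_lt with rfl | hr0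
  · simp [Real.zero_rpow hcrit.ne']
  have hs : 0 < Real.pi / 2 * r := by positivity
  have h := sub_sin_mul_rpow_le hs
  rw [Real.mul_rpow (by positivity) hr] at h
  have hp : 0 < (Real.pi / 2) ^ (-(critExp + 1)) := by positivity
  have h1 : (Real.pi / 2 * r - Real.sin (Real.pi / 2 * r)) * r ^ (-(critExp + 1))
      ≤ Real.pi / 2 - 1 := by
    refine le_of_mul_le_mul_right ?_ hp
    linarith
  have hrp : 0 < r ^ critExp := Real.rpow_pos_of_pos hr0 _
  rw [Real.rpow_neg hr, Real.rpow_add_one hr0.ne', ← div_eq_mul_inv,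
    div_le_iff₀ (by positivity)] at h1
  rw [Real.sinc_of_ne_zero hs.ne']
  have h2 : (1 + critExp) = critExp * (Real.pi / 2) := by linarith [critExp_mul]
  have h3 : (1 + critExp) * (1 - Real.sin (Real.pi / 2 * r) / (Real.pi / 2 * r))
      = critExp * (Real.pi / 2 * r - Real.sin (Real.pi / 2 * r)) / r := by
    rw [h2]; field_simp
  rw [h3, div_le_iff₀ hr0]
  calc critExp * (Real.pi / 2 * r - Real.sin (Real.pi / 2 * r))
      ≤ critExp * ((Real.pi / 2 - 1) * (r ^ critExp * r)) := by gcongr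
    _ = critExp * (Real.pi / 2 - 1) * (r ^ critExp * r) := by ring
    _ = r ^ critExp * r := by rw [critExp_mul, one_mul]

theorem minorant_crit {α r : ℝ} (hα : critExp ≤ α) (hr : 0 ≤ r) :
    1 + α / (Real.sinc (Real.pi / 2) - Real.cos (Real.pi / 2)) * Real.sinc (Real.pi / 2)
      - α / (Real.sinc (Real.pi / 2) - Real.cos (Real.pi / 2)) * Real.sinc (Real.pi / 2 * r)
      ≤ r ^ α := by
  have hpi := Real.pi_pos
  have hcrit : 0 < critExp := lt_trans (by positivity) pi_div_two_lt_critExp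
  have h1 := rpow_sub_one_mul_le hcrit hα hr
  have h2 := one_sub_sinc_le hr
  have h3 : α / critExp * ((1 + critExp) * (1 - Real.sinc (Real.pi / 2 * r)) - 1)
      ≤ α / critExp * (r ^ critExp - 1) := by
    have : 0 < α := hcrit.trans_le hα
    gcongr
  rw [Real.cos_pi_div_two, sub_zero, div_mul_cancel₀]
  · have h4 : α / Real.sinc (Real.pi / 2) = α * (Real.pi / 2) := by
      rw [Real.sinc_of_ne_zero (by positivity), Real.sin_pi_div_two, div_div_eq_mul_div, div_one]
    have h5 : α / critExp * ((1 + critExp) * (1 - Real.sinc (Real.pi / 2 * r)) - 1)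
        = α - α * (Real.pi / 2) * Real.sinc (Real.pi / 2 * r) := by
      have h6 : (1 + critExp) = critExp * (Real.pi / 2) := by linarith [critExp_mul]
      have h7 : α / critExp * (critExp * (Real.pi / 2) - 1) = α := by
        rw [← h6, add_sub_cancel_left, div_mul_cancel₀ _ hcrit.ne']
      have h8 : α / critExp * critExp = α := div_mul_cancel₀ _ hcrit.ne'
      rw [h6]
      linear_combination h7 - (Real.pi / 2) * Real.sinc (Real.pi / 2 * r) * h8
    rw [h4]
    linarith
  · rw [Real.sinc_of_ne_zero (by positivity), Real.sin_pi_div_two]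
    positivity

/-! ### Optimality of the sphere -/

theorem sinc_mul_rpow_eq {β l : ℝ} (hl : 0 < l) :
    Real.sinc (2 * Real.pi * l) * l ^ β
      = Real.sin (2 * Real.pi * l) / (2 * Real.pi * l ^ (1 - β)) := by
  have hpi := Real.pi_pos
  rw [Real.sinc_of_ne_zero (by positivity), Real.rpow_sub hl, Real.rpow_one]
  have : 0 < l ^ β := by positivity
  field_simp

theorem C_μ₄ {α β l : ℝ} (hβ0 : 0 < β) (hβ1 : β ≤ 1) (hl : IsLambda β l) :
    C α β μ₄ = ENNReal.ofReal
      ((Real.sin (2 * Real.pi * l) / (2 * Real.pi * l ^ (1 - β))) ^ α) := by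
  have hpi := Real.pi_pos
  obtain ⟨hθ, -⟩ := hl.angle
  have hl0 : 0 < l := pos_of_mul_pos_right hθ.1 (by positivity)
  have hsin : 0 < Real.sin (2 * Real.pi * l) :=
    Real.sin_pos_of_pos_of_lt_pi hθ.1 (by linarith [hθ.2])
  have hval : 0 < Real.sinc (2 * Real.pi * l) * l ^ β := by
    rw [sinc_mul_rpow_eq hl0]; positivity
  rw [C_eq_ofReal (by positivity) (by positivity) (by positivity)
    (weightedFourierNorm_μ₄ hβ0 hβ1 hl) (moment_μ₄ α) μ₄_univ]
  congr 1
  rw [← sinc_mul_rpow_eq hl0, Real.mul_rpow (by positivity) hval.le,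
    Real.rpow_add (by positivity)]
  have : 0 < (4 * Real.pi) ^ α := by positivity
  have : 0 < (4 * Real.pi) ^ β := by positivity
  field_simp

/-- Duality with the single frequency `l`. The tangent equation reads `cos = (1 - β) sinc` at `2πl`,
so `A = 1 + α/β` and the optimal share is `a = 1`. -/
theorem C_space_ge {α β l : ℝ} (hα : 0 < α) (hβ0 : 0 < β) (hl : IsLambda β l)
    (hmin : ∀ r, 0 ≤ r → 1 + α / (Real.sinc (2 * Real.pi * l) - Real.cos (2 * Real.pi * l))
        * Real.sinc (2 * Real.pi * l)
      - α / (Real.sinc (2 * Real.pi * l) - Real.cos (2 * Real.pi * l))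
        * Real.sinc (2 * Real.pi * l * r) ≤ r ^ α)
    {μ : Measure E3} [IsFiniteMeasure μ] (hμ : μ ≠ 0) :
    ENNReal.ofReal ((Real.sin (2 * Real.pi * l) / (2 * Real.pi * l ^ (1 - β))) ^ α)
      ≤ C α β μ := by
  have hpi := Real.pi_pos
  obtain ⟨hθ, -⟩ := hl.angle
  have hl0 : 0 < l := pos_of_mul_pos_right hθ.1 (by positivity)
  have hsin : 0 < Real.sin (2 * Real.pi * l) :=
    Real.sin_pos_of_pos_of_lt_pi hθ.1 (by linarith [hθ.2])
  have hsinc : 0 < Real.sinc (2 * Real.pi * l) := by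
    rw [Real.sinc_of_ne_zero hθ.1.ne']; exact div_pos hsin hθ.1
  have hκ : 0 < Real.sinc (2 * Real.pi * l) - Real.cos (2 * Real.pi * l) := by
    rw [sinc_sub_cos hθ.1]
    exact mul_pos (pow_pos hθ.1 2) (lt_of_lt_of_le (by positivity) (besselRatio_ge hθ))
  set B := α / (Real.sinc (2 * Real.pi * l) - Real.cos (2 * Real.pi * l)) with hB
  have hB0 : 0 < B := div_pos hα hκ
  have key := ofReal_le_C_of_kernel (α := α) (β := β) hμ hα hβ0
    (A := 1 + B * Real.sinc (2 * Real.pi * l)) (a := 1) (D := B * l ^ (-β)) one_pos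
    (by linarith [mul_pos hB0 hsinc]) (by positivity)
    (k := fun u => Real.sinc (2 * Real.pi * u)) (by fun_prop) (fun x => Real.abs_sinc_le_one _)
    (fun hS ρ hρ => abs_integral_sinc_le hS hρ)
    (c := fun _ : Unit => B) (ρ := fun _ : Unit => l) (fun _ => hl0) (hasSum_fintype _).summable
    ?_ ?_
  · convert! key using 2
    rw [← sinc_mul_rpow_eq hl0, Real.one_rpow, mul_one, Real.rpow_neg hl0.le]
    congr 1
    have : 0 < l ^ β := by positivity
    field_simp
    ring
  · convert! hasSum_fintype (fun _ : Unit => |B| * l ^ (-β)) using 1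
    simp [abs_of_pos hB0]
  · intro r hr
    simp only [tsum_fintype, Finset.univ_unique, Finset.sum_const, Finset.card_singleton, one_smul]
    rw [← mul_assoc]
    exact hmin r hr

end SphereExtremal

end AveragingUncertainty

/-! ### The four sharp constants -/

theorem mainTheorem1 :
    (∀ α : ℝ, 2 ≤ α →
      AveragingUncertainty.Cstar ℝ α 1
          = AveragingUncertainty.C α 1
              (AveragingUncertainty.densityMeasure AveragingUncertainty.f₁) ∧
      AveragingUncertainty.C α 1
          (AveragingUncertainty.densityMeasure AveragingUncertainty.f₁)
          = ENNReal.ofReal (1 / ((2 * Real.pi) ^ α * (α + 1)))) ∧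
    (AveragingUncertainty.Cstar ℝ 1 2
          = AveragingUncertainty.C 1 2
              (AveragingUncertainty.densityMeasure AveragingUncertainty.f₂) ∧
      AveragingUncertainty.C 1 2
          (AveragingUncertainty.densityMeasure AveragingUncertainty.f₂)
          = ENNReal.ofReal (1 / (9 * Real.pi ^ 2))) ∧
    (AveragingUncertainty.Cstar AveragingUncertainty.E3 1 2
          = AveragingUncertainty.C 1 2
              (AveragingUncertainty.densityMeasure AveragingUncertainty.f₃) ∧
      AveragingUncertainty.C 1 2
          (AveragingUncertainty.densityMeasure AveragingUncertainty.f₃)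
          = ENNReal.ofReal (4 / (9 * Real.pi ^ 2))) ∧
    (∀ α β : ℝ,
      ((β = 1 ∧ (Real.pi / 2 - 1)⁻¹ ≤ α) ∨ (2 ≤ α ∧ 0 < β ∧ β < 1)) →
      (∃! l : ℝ, AveragingUncertainty.IsLambda β l) ∧
      ∀ l : ℝ, AveragingUncertainty.IsLambda β l →
        AveragingUncertainty.Cstar AveragingUncertainty.E3 α β
            = AveragingUncertainty.C α β AveragingUncertainty.μ₄ ∧
        AveragingUncertainty.C α β AveragingUncertainty.μ₄
            = ENNReal.ofReal
                ((Real.sin (2 * Real.pi * l) / (2 * Real.pi * l ^ (1 - β))) ^ α)) := by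
  open AveragingUncertainty in
  have hpi := Real.pi_pos
  refine ⟨fun α hα => ⟨?_, C_f₁ hα⟩, ⟨?_, C_f₂⟩, ⟨?_, C_f₃⟩, fun α β h => ?_⟩
  · have := isFiniteMeasure_densityMeasure f₁_nonneg integrable_f₁
    exact Cstar_eq_C (ne_zero_of_univ_eq_ofReal one_pos
      (by rw [densityMeasure_univ f₁_nonneg integrable_f₁, integral_f₁])) (C_f₁ hα)
      fun ν _ hν => C_one_line_ge hα hν
  · have := isFiniteMeasure_densityMeasure f₂_nonneg integrable_f₂
    exact Cstar_eq_C (ne_zero_of_univ_eq_ofReal one_pos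
      (by rw [densityMeasure_univ f₂_nonneg integrable_f₂, integral_f₂])) C_f₂
      fun ν _ hν => C_one_two_line_ge hν
  · have := isFiniteMeasure_densityMeasure f₃_nonneg integrable_f₃
    exact Cstar_eq_C (ne_zero_of_univ_eq_ofReal (m := 2 * Real.pi) (by positivity)
      (by rw [densityMeasure_univ f₃_nonneg integrable_f₃, integral_f₃])) C_f₃
      fun ν _ hν => C_one_two_space_ge hν
  · have hβ0 : 0 < β := by rcases h with ⟨rfl, -⟩ | ⟨-, h, -⟩ <;> [exact one_pos; exact h]
    have hβ1 : β ≤ 1 := by rcases h with ⟨rfl, -⟩ | ⟨-, -, h⟩ <;> [exact le_rfl; exact h.le]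
    refine ⟨existsUnique_isLambda hβ0 hβ1, fun l hl => ⟨?_, C_μ₄ hβ0 hβ1 hl⟩⟩
    have hα : 0 < α := by
      rcases h with ⟨-, h⟩ | ⟨h, -, -⟩
      · exact (lt_trans (by positivity) pi_div_two_lt_critExp).trans_le h
      · linarith
    refine Cstar_eq_C μ₄_ne_zero (C_μ₄ hβ0 hβ1 hl) fun ν _ hν =>
      C_space_ge hα hβ0 hl (fun r hr => ?_) hν
    -- For `β = 1` the angle is exactly `π/2`, where the minorant persists below `α = 2`; for `β <
    -- 1` the quadratic minorant works at every admissible angle.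
    rcases h with ⟨rfl, h⟩ | ⟨h, -, -⟩
    · have hl' : 2 * Real.pi * l = Real.pi / 2 := by
        rcases hl with ⟨-, rfl⟩ | ⟨h, -⟩
        · ring
        · exact absurd h (lt_irrefl _)
      rw [hl']
      exact minorant_crit h hr
    · exact minorant_two h hl.angle.1 hr
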